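/- Let $\Omega\subset\mathbb C^d$, $d\ge 1$, be an irreducible bounded symmetric domain: a bounded domain each of whose points is an isolated fixed point of an involutive holomorphic automorphism of $\Omega$, and which is not biholomorphic to a product of two bounded symmetric domains of positive dimension. Let $\gamma = 2+a(r-1)+b$ be its genus, where $r$ is the rank and $a,b$ are the multiplicities of $\Omega$; equivalently $\gamma = 2+\dim_{\mathbb C}\ker(D(e,e)-1)$ for a primitive tripotent $e$ of the Jordan triple system $\{u,v,x\}=D(u,v)x=-R(u,\bar v)x$ on a tangent space of $\Omega$, where $R$ is the curvature of the Bergman metric, and $e\neq 0$ is a primitive tripotent if $\ker(D(e,e)-2)=\mathbb C e$. Let $V(\Omega)$ be the Euclidean volume of $\Omega$, $K$ its Bergman kernel, and $N(z,z)=(V(\Omega)K(z,z))^{-1/\gamma}$ its generic norm. For a real number $\mu>0$ let $$M_\Omega(\mu)=\{(z,w)\in\Omega\times\mathbb C:\ |w|^2<N^\mu(z,z)\}\subset\mathbb C^{d+1}$$ be the Cartan–Hartogs domain over $\Omega$, with the Kähler metric $g(\mu)_{\alpha\bar\beta}=\dfrac{\partial^2\Phi}{\partial z_\alpha\partial\bar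 z_\beta}$, $1\le\alpha,\beta\le d+1$, where $z_{d+1}=w$ and $\Phi(z,w)=-\log(N^\mu(z,z)-|w|^2)$. For a Kähler metric $g$ put $\mathrm{Ric}_{\alpha\bar\beta}=-\dfrac{\partial^2\log\det g}{\partial z_\alpha\partial\bar z_\beta}$ and $\kappa_g=\sum_{\alpha,\beta}g^{\beta\bar\alpha}\mathrm{Ric}_{\alpha\bar\beta}$, where $(g^{\beta\bar\alpha})$ is the inverse matrix of $(g_{\alpha\bar\beta})$. Call $g$ extremal if the $(1,0)$-part of the Hamiltonian vector field of $\kappa_g$ is holomorphic, that is, if for every $\alpha$ the function $\sum_{\beta}g^{\beta\bar\alpha}\,\partial\kappa_g/\partial\bar z_\beta$ is holomorphic, and Kähler–Einstein if $\mathrm{Ric}=c\,g$ for some real constant $c$. Then, for every such $\Omega$ and every $\mu>0$, the metric $g(\mu)$ on $M_\Omega(\mu)$ is extremal if and only if it is Kähler–Einstein. -/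

import Mathlib

open scoped ComplexConjugate

namespace CartanHartogs

noncomputable section

/-! ### Wirtinger derivatives and Kähler geometry in global coordinates of `ℂⁿ` -/

/-- The Wirtinger derivative `∂f/∂z_i`. -/
def dz {n : ℕ} (i : Fin n) (f : (Fin n → ℂ) → ℂ) (p : Fin n → ℂ) : ℂ :=
  (1 / 2 : ℂ) * (fderiv ℝ f p (Pi.single i 1) - Complex.I * fderiv ℝ f p (Pi.single i Complex.I))

/-- The Wirtinger derivative `∂f/∂z̄_i`. -/
def dzbar {n : ℕ} (i : Fin n) (f : (Fin n → ℂ) → ℂ) (p : Fin n → ℂ) : ℂ :=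
  (1 / 2 : ℂ) * (fderiv ℝ f p (Pi.single i 1) + Complex.I * fderiv ℝ f p (Pi.single i Complex.I))

/-- The matrix `g_{αβ̄} = ∂²Φ/∂z_α∂z̄_β` of the Kähler metric with (real) potential `Φ`,
whose Kähler form is `(i/2) ∂∂̄Φ`. -/
def metricOfPotential {n : ℕ} (Φ : (Fin n → ℂ) → ℝ) (p : Fin n → ℂ) :
    Matrix (Fin n) (Fin n) ℂ :=
  Matrix.of fun α β => dz α (dzbar β fun q => (Φ q : ℂ)) p

/-- The Ricci tensor `Ric_{αβ̄} = -∂² log det g / ∂z_α∂z̄_β` of a Kähler metric `g`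
(the determinant of a Hermitian matrix is real). -/
def ricci {n : ℕ} (g : (Fin n → ℂ) → Matrix (Fin n) (Fin n) ℂ) (p : Fin n → ℂ) :
    Matrix (Fin n) (Fin n) ℂ :=
  Matrix.of fun α β => -dz α (dzbar β fun q => (Real.log (g q).det.re : ℂ)) p

/-- The scalar curvature `κ_g = ∑ g^{βᾱ} Ric_{αβ̄}`, where `(g^{βᾱ})` is the inverse matrix
of `(g_{αβ̄})`. -/
def scalarCurvature {n : ℕ} (g : (Fin n → ℂ) → Matrix (Fin n) (Fin n) ℂ) (p : Fin n → ℂ) : ℂ :=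
  ∑ α, ∑ β, (g p)⁻¹ β α * ricci g p α β

/-- The components of the `(1,0)`-part of the Hamiltonian vector field `X` of the scalar curvature,
`ι_X ω = dκ_g` with `ω = (i/2) ∑ g_{αβ̄} dz_α ∧ dz̄_β`; that is, the solution `ξ` of
`(i/2) ∑_α g_{αβ̄} ξ_α = ∂κ_g/∂z̄_β`. -/
def hamiltonianField {n : ℕ} (g : (Fin n → ℂ) → Matrix (Fin n) (Fin n) ℂ) (p : Fin n → ℂ) :
    Fin n → ℂ :=
  fun α => -2 * Complex.I * ∑ β, (g p)⁻¹ β α * dzbar β (scalarCurvature g) p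

/-- A Kähler metric `g` on the open set `U ⊆ ℂⁿ` is extremal if the `(1,0)`-part of the Hamiltonian
vector field of its scalar curvature is holomorphic. -/
def IsExtremal {n : ℕ} (g : (Fin n → ℂ) → Matrix (Fin n) (Fin n) ℂ) (U : Set (Fin n → ℂ)) : Prop :=
  DifferentiableOn ℂ (hamiltonianField g) U

/-- A Kähler metric `g` on `U ⊆ ℂⁿ` is Kähler–Einstein if `Ric = c g` for a real constant `c`. -/
def IsKahlerEinstein {n : ℕ} (g : (Fin n → ℂ) → Matrix (Fin n) (Fin n) ℂ)
    (U : Set (Fin n → ℂ)) : Prop :=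
  ∃ c : ℝ, ∀ p ∈ U, ricci g p = (c : ℂ) • g p

/-! ### Bounded symmetric domains -/

/-- `U` and `V` are biholomorphic. -/
def Biholomorphic {E F : Type*} [NormedAddCommGroup E] [NormedSpace ℂ E]
    [NormedAddCommGroup F] [NormedSpace ℂ F] (U : Set E) (V : Set F) : Prop :=
  ∃ (f : E → F) (f' : F → E), DifferentiableOn ℂ f U ∧ DifferentiableOn ℂ f' V ∧
    Set.MapsTo f U V ∧ Set.MapsTo f' V U ∧ Set.LeftInvOn f' f U ∧ Set.RightInvOn f' f V

/-- A bounded symmetric domain of `ℂᵈ`: a bounded domain each of whose points is an isolated fixed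
point of an involutive holomorphic automorphism of the domain. -/
structure IsBoundedSymmetricDomain {d : ℕ} (Ω : Set (Fin d → ℂ)) : Prop where
  isOpen : IsOpen Ω
  isConnected : IsConnected Ω
  isBounded : Bornology.IsBounded Ω
  symmetric : ∀ p ∈ Ω, ∃ s : (Fin d → ℂ) → (Fin d → ℂ),
    DifferentiableOn ℂ s Ω ∧ Set.MapsTo s Ω Ω ∧ (∀ z ∈ Ω, s (s z) = z) ∧
      s p = p ∧ ∀ᶠ z in nhdsWithin p {p}ᶜ, s z ≠ z

/-- A bounded symmetric domain is irreducible if it has positive dimension and is not biholomorphic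
to a product of two bounded symmetric domains of positive dimensions. -/
structure IsIrreducibleBoundedSymmetricDomain {d : ℕ} (Ω : Set (Fin d → ℂ)) : Prop
    extends IsBoundedSymmetricDomain Ω where
  dim_pos : 0 < d
  irreducible : ∀ (k l : ℕ) (D₁ : Set (Fin k → ℂ)) (D₂ : Set (Fin l → ℂ)), 0 < k → 0 < l →
    IsBoundedSymmetricDomain D₁ → IsBoundedSymmetricDomain D₂ → ¬ Biholomorphic Ω (D₁ ×ˢ D₂)

/-! ### Bergman kernel and Bergman metric -/

/-- `f` lies in the Bergman space of square integrable holomorphic functions on `Ω`. -/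
def MemBergman {d : ℕ} (Ω : Set (Fin d → ℂ)) (f : (Fin d → ℂ) → ℂ) : Prop :=
  DifferentiableOn ℂ f Ω ∧ MeasureTheory.MemLp f 2 (MeasureTheory.volume.restrict Ω)

/-- `k` represents the evaluation at `w` on the Bergman space of `Ω`. -/
def Reproduces {d : ℕ} (Ω : Set (Fin d → ℂ)) (w : Fin d → ℂ) (k : (Fin d → ℂ) → ℂ) : Prop :=
  MemBergman Ω k ∧ ∀ f, MemBergman Ω f → ∫ z in Ω, f z * conj (k z) = f w

open Classical in
/-- The Bergman kernel `K(z, w)` of `Ω`: as a function of `z` it is the element of the Bergman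
space (unique as a function on `Ω`) that represents the evaluation at `w`. -/
def bergmanKernel {d : ℕ} (Ω : Set (Fin d → ℂ)) (z w : Fin d → ℂ) : ℂ :=
  if h : ∃ k, Reproduces Ω w k then Classical.choose h z else 0

/-- The Bergman metric `∂² log K(z, z) / ∂z_j∂z̄_k`. -/
def bergmanMetric {d : ℕ} (Ω : Set (Fin d → ℂ)) :
    (Fin d → ℂ) → Matrix (Fin d) (Fin d) ℂ :=
  metricOfPotential fun z => Real.log (bergmanKernel Ω z z).re

/-! ### Genus and generic norm -/

/-- The curvature endomorphism `R(u, v̄)` of the Kähler metric `g` at `p`. It sends `x` to the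
vector with components `-∑ u_k v̄_l x_i ∂/∂z̄_l (∑_j ∂g_{ij̄}/∂z_k g^{jm̄})`; lowering the index `m`
gives `R_{ih̄kl̄} = -∂²g_{ih̄}/∂z_k∂z̄_l + ∑ ∂g_{iq̄}/∂z_k g^{qp̄} ∂g_{ph̄}/∂z̄_l`. -/
def curvature {d : ℕ} (g : (Fin d → ℂ) → Matrix (Fin d) (Fin d) ℂ) (p u v : Fin d → ℂ) :
    Module.End ℂ (Fin d → ℂ) :=
  Matrix.toLin' <| Matrix.of fun m i => -∑ k, ∑ l, u k * conj (v l) *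
    dzbar l (fun q => ∑ j, dz k (fun r => g r i j) q * (g q)⁻¹ j m) p

/-- The operators `D(u, v)` of the Hermitian positive Jordan triple system `{u, v, x} = D(u, v) x`
on the tangent space of the bounded symmetric domain `Ω` at `p`: minus the curvature of the Bergman
metric. (For the unit ball at the origin, `D(u, v) x = ⟨u, v⟩ x + ⟨x, v⟩ u`.) -/
def jordanD {d : ℕ} (Ω : Set (Fin d → ℂ)) (p u v : Fin d → ℂ) : Module.End ℂ (Fin d → ℂ) :=
  -curvature (bergmanMetric Ω) p u v

/-- `e` is a primitive (rank one) tripotent at `p`: `e ≠ 0`, and the Peirce space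
`V₂(e) = ker (D(e, e) - 2)` is the line `ℂ e`; in particular `{e, e, e} = 2e`. -/
def IsPrimitiveTripotent {d : ℕ} (Ω : Set (Fin d → ℂ)) (p e : Fin d → ℂ) : Prop :=
  e ≠ 0 ∧ Module.End.eigenspace (jordanD Ω p e e) 2 = Submodule.span ℂ {e}

/-- The genus `γ = 2 + a(r - 1) + b` of an irreducible bounded symmetric domain of rank `r` with
multiplicities `a`, `b`. The number `a(r - 1) + b` is the dimension of the Peirce space
`V₁(e) = ker (D(e, e) - 1)` of a primitive tripotent `e`; by homogeneity it is the same for all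
points `p` and all primitive tripotents `e`. -/
def genus {d : ℕ} (Ω : Set (Fin d → ℂ)) : ℕ :=
  2 + sInf {m : ℕ | ∃ p ∈ Ω, ∃ e, IsPrimitiveTripotent Ω p e ∧
    m = Module.finrank ℂ (Module.End.eigenspace (jordanD Ω p e e) 1)}

/-- The generic norm `N(z, z) = (V(Ω) K(z, z))^(-1/γ)`. -/
def genericNorm {d : ℕ} (Ω : Set (Fin d → ℂ)) (z : Fin d → ℂ) : ℝ :=
  (MeasureTheory.volume.real Ω * (bergmanKernel Ω z z).re) ^ (-(1 / (genus Ω : ℝ)))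

/-! ### Cartan–Hartogs domains; a point `(z, w)` of `ℂᵈ × ℂ = ℂᵈ⁺¹` is a function on `Fin (d + 1)`
with `z` its first `d` values and `w` its last value -/

/-- The Cartan–Hartogs domain `M_Ω(μ) = {(z, w) | z ∈ Ω, |w|² < N(z, z)^μ}`. -/
def domain {d : ℕ} (Ω : Set (Fin d → ℂ)) (μ : ℝ) : Set (Fin (d + 1) → ℂ) :=
  {p | Fin.init p ∈ Ω ∧ ‖p (Fin.last d)‖ ^ 2 < genericNorm Ω (Fin.init p) ^ μ}

/-- The Kähler potential `Φ(z, w) = -log (N(z, z)^μ - |w|²)`. -/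
def potential {d : ℕ} (Ω : Set (Fin d → ℂ)) (μ : ℝ) (p : Fin (d + 1) → ℂ) : ℝ :=
  -Real.log (genericNorm Ω (Fin.init p) ^ μ - ‖p (Fin.last d)‖ ^ 2)

/-- The Kähler metric `g(μ)` on the Cartan–Hartogs domain `M_Ω(μ)`. -/
def metric {d : ℕ} (Ω : Set (Fin d → ℂ)) (μ : ℝ) :
    (Fin (d + 1) → ℂ) → Matrix (Fin (d + 1)) (Fin (d + 1)) ℂ :=
  metricOfPotential (potential Ω μ)

end

end CartanHartogs

/-!
The metric `g(μ)` is analysed through `u = log K(z, z)`, the potential of the Bergman metric.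
Since `N(z, z)^μ = exp(-ν u + b)` with `ν = μ / γ`, the genus enters only as a positive factor,
and the theorem follows from one fact about `Ω`: the volume density of the Bergman metric is a
constant multiple of `K(z, z) = exp u` (`IsBoundedSymmetricDomain.exists_det_bergmanMetric_eq`).

No homogeneity is needed for this. The quotient `ψ = det(∂∂̄u) / K` is invariant under every
holomorphic involution of `Ω`, because `K` and `det(∂∂̄u)` transform by the same factor
`|det s'|²`. The symmetry `s` at `p` has differential `-1` at `p` (`fderiv_symmetry_eq_neg`), so
`ψ = ψ ∘ s` gives `dψ(p) = -dψ(p)`, that is `dψ = 0`, and `ψ` is constant on the connected set `Ω`. The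
analysis behind it is the smoothness of `K(z, z)` and the positivity of the Bergman metric. Both
come from a holomorphic map `k` of `Ω` into a Hilbert space with `K(z, w) = ⟨k(w), k(z)⟩`
(`exists_bergman_map`), which is obtained from the Riesz representation of the point evaluations
on the Bergman space, after the needed facts on holomorphic maps of several variables have been
derived from the one-variable theory.

With `E = N^μ`, `h = E - |w|²` and `B = ∂∂̄u`, the metric is `E / h²` times the block matrix
`[[ν h B + ν² |w|² ∂u ∂̄u, ν w ∂u], [ν w̄ ∂̄u, 1]]`. Its determinant is `(E / h²)^(d+1) (ν h)^d det B`,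
which yields `Ric = -(d+2) g - (1 - (d+1)ν) ∂∂̄u` (`IsHartogsBase.ricci_metric`) and the scalar
curvature `κ = -(d+2)(d+1) - (1 - (d+1)ν) (d/ν) (h/E)` (`IsHartogsBase.scalarCurvature_metric`).
The gradient of `κ` is vertical, with last component a multiple of `w h² / E²` by a constant
that vanishes only for `(d+1)ν = 1`, and `w h² / E²` is not holomorphic in `w`. Hence an extremal
metric has `(d+1)ν = 1`, and then `Ric = -(d+2) g`. Conversely, the scalar curvature of a
Kähler–Einstein metric is constant.
-/

namespace CartanHartogs

open Metric Filter Topology MeasureTheory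

/-! ### Holomorphic maps of several variables -/

section Holomorphic

variable {E F : Type*} [NormedAddCommGroup E] [NormedSpace ℂ E]
  [NormedAddCommGroup F] [NormedSpace ℂ F]

lemma add_smul_mem_ball {z v : E} {r R : ℝ} (hr : 0 < r) (hv : R * ‖v‖ ≤ r) {t : ℂ}
    (ht : ‖t‖ < R) : z + t • v ∈ ball z r := by
  rw [mem_ball_iff_norm, add_sub_cancel_left, norm_smul]
  rcases eq_or_ne v 0 with rfl | hv0
  · simpa using hr
  · exact lt_of_lt_of_le (mul_lt_mul_of_pos_right ht (norm_pos_iff.2 hv0)) hv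

lemma differentiableOn_line {f : E → F} {z v : E} {r R : ℝ} (hr : 0 < r)
    (hf : DifferentiableOn ℂ f (ball z r)) (hv : R * ‖v‖ ≤ r) :
    DifferentiableOn ℂ (fun t : ℂ => f (z + t • v)) (ball 0 R) :=
  hf.comp (by fun_prop) fun _ ht => add_smul_mem_ball hr hv (mem_ball_zero_iff.1 ht)

lemma deriv_line {f : E → F} {z v : E} (hf : DifferentiableAt ℂ f z) :
    deriv (fun t : ℂ => f (z + t • v)) 0 = fderiv ℂ f z v := by
  have h1 : HasDerivAt (fun t : ℂ => z + t • v) v 0 := by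
    simpa using ((hasDerivAt_id (0 : ℂ)).smul_const v).const_add z
  have h2 : HasFDerivAt f (fderiv ℂ f z) (z + (0 : ℂ) • v) := by
    simpa using hf.hasFDerivAt
  exact (h2.comp_hasDerivAt (0 : ℂ) h1).deriv

/-- **Cauchy's estimate** for the derivative of a bounded holomorphic map. -/
lemma norm_fderiv_le_of_bound {f : E → F} {z : E} {r M : ℝ} (hr : 0 < r)
    (hf : DifferentiableOn ℂ f (ball z r)) (hM : ∀ x ∈ ball z r, ‖f x‖ ≤ M) :
    ‖fderiv ℂ f z‖ ≤ 2 * M / r := by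
  have hM0 : 0 ≤ M := (norm_nonneg _).trans (hM z (mem_ball_self hr))
  refine ContinuousLinearMap.opNorm_le_bound _ (by positivity) fun v => ?_
  rcases eq_or_ne v 0 with rfl | hv0
  · simp
  have hv : 0 < ‖v‖ := norm_pos_iff.2 hv0
  have hd := differentiableOn_line (R := r / ‖v‖) hr hf (by field_simp; rfl)
  have hR : 0 < r / ‖v‖ := by positivity
  have hsub : closedBall (0 : ℂ) (r / ‖v‖ / 2) ⊆ ball 0 (r / ‖v‖) :=
    closedBall_subset_ball (by linarith)
  have hcl : DiffContOnCl ℂ (fun t : ℂ => f (z + t • v)) (ball 0 (r / ‖v‖ / 2)) :=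
    (hd.mono (closure_ball_subset_closedBall.trans hsub)).diffContOnCl
  have := Complex.norm_deriv_le_of_forall_mem_sphere_norm_le (by positivity) hcl
    (C := M) fun t ht => hM _ (add_smul_mem_ball hr (R := r / ‖v‖) (by field_simp; rfl)
      (mem_ball_zero_iff.1 (hsub (sphere_subset_closedBall ht))))
  rw [deriv_line (hf.differentiableAt (ball_mem_nhds z hr))] at this
  refine this.trans (le_of_eq ?_)
  field_simp

/-- A locally uniform limit of holomorphic maps into a Banach space is holomorphic. -/
lemma differentiableOn_of_tendstoLocallyUniformlyOn [CompleteSpace F] {U : Set E} (hU : IsOpen U)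
    {f : ℕ → E → F} {g : E → F} (hf : ∀ n, DifferentiableOn ℂ (f n) U)
    (hlim : ∀ z ∈ U, ∃ r > 0, TendstoUniformlyOn f g atTop (ball z r)) :
    DifferentiableOn ℂ g U := by
  intro z hz
  obtain ⟨r₁, hr₁, hr₁U⟩ := isOpen_iff.1 hU z hz
  obtain ⟨r₂, hr₂, hu⟩ := hlim z hz
  set r := min r₁ r₂ / 2 with hr_def
  have hr : 0 < r := by positivity
  have hsub : ∀ x ∈ ball z r, ball x r ⊆ ball z r₁ ∩ ball z r₂ := by
    intro x hx y hy
    have : dist y z < min r₁ r₂ := by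
      have := dist_triangle y x z
      rw [mem_ball] at hx hy
      linarith
    exact ⟨lt_of_lt_of_le this (min_le_left _ _), lt_of_lt_of_le this (min_le_right _ _)⟩
  have hcau : UniformCauchySeqOn (fun n => fderiv ℂ (f n)) atTop (ball z r) := by
    rw [Metric.uniformCauchySeqOn_iff]
    intro ε hε
    obtain ⟨N, hN⟩ := (Metric.uniformCauchySeqOn_iff.1 hu.uniformCauchySeqOn) (ε * r / 4)
      (by positivity)
    refine ⟨N, fun m hm n hn x hx => ?_⟩
    have hxU : x ∈ U := hr₁U (hsub x hx (mem_ball_self hr)).1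
    have hd : ∀ k, DifferentiableAt ℂ (f k) x := fun k =>
      (hf k).differentiableAt (hU.mem_nhds hxU)
    rw [dist_eq_norm, ← fderiv_sub (hd m) (hd n)]
    have := norm_fderiv_le_of_bound (f := f m - f n) (z := x) (M := ε * r / 4) hr
      (((hf m).sub (hf n)).mono fun y hy => hr₁U (hsub x hx hy).1) fun y hy => by
        simpa [dist_eq_norm] using (hN m hm n hn y (hsub x hx hy).2).le
    refine lt_of_le_of_lt this ?_
    have : 2 * (ε * r / 4) / r = ε / 2 := by field_simp; norm_num
    rw [this]; linarith
  have hzz := mem_ball_self (x := z) hr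
  have hex : ∀ x ∈ ball z r, ∃ L, Tendsto (fun n => fderiv ℂ (f n) x) atTop (𝓝 L) :=
    fun x hx => cauchySeq_tendsto_of_complete (hcau.cauchySeq hx)
  choose! g' hg' using hex
  have := hasFDerivAt_of_tendstoUniformlyOn isOpen_ball
    (hcau.tendstoUniformlyOn_of_tendsto hg')
    (fun n x hx => ((hf n).differentiableAt
      (hU.mem_nhds (hr₁U (hsub x hx (mem_ball_self hr)).1))).hasFDerivAt)
    (fun x hx => hu.tendsto_at (hsub x hx (mem_ball_self hr)).2) hzz
  exact this.differentiableAt.differentiableWithinAt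

/-- The quadratic bound for the first order Taylor remainder in one variable. -/
lemma norm_taylor_remainder_le [CompleteSpace F] {g : ℂ → F} {R M : ℝ} (hR : 0 < R)
    (hg : DifferentiableOn ℂ g (ball 0 R)) (hM : ∀ t ∈ ball (0 : ℂ) R, ‖g t‖ ≤ M) {t : ℂ}
    (ht : ‖t‖ < R / 4) : ‖g t - g 0 - t • deriv g 0‖ ≤ 32 * M / R ^ 2 * ‖t‖ ^ 2 := by
  have key : ∀ {h : ℂ → F} {s : ℂ} {ρ B : ℝ}, 0 < ρ → DifferentiableOn ℂ h (ball s ρ) →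
      (∀ x ∈ ball s ρ, ‖h x‖ ≤ B) → ‖deriv h s‖ ≤ 2 * B / ρ := by
    intro h s ρ B hρ hh hB
    rw [norm_deriv_eq_norm_fderiv]
    exact norm_fderiv_le_of_bound hρ hh hB
  have hM0 : 0 ≤ M := (norm_nonneg _).trans (hM 0 (mem_ball_self hR))
  have hsub : ∀ {s : ℂ} {a b : ℝ}, s ∈ ball (0 : ℂ) a → ball s b ⊆ ball 0 (a + b) := by
    intro s a b hs
    refine ball_subset_ball' ?_
    rw [mem_ball] at hs
    linarith
  have h1 : ∀ s ∈ ball (0 : ℂ) (R / 2), ‖deriv g s‖ ≤ 4 * M / R := by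
    intro s hs
    have hs' : ball s (R / 2) ⊆ ball 0 R := by simpa using hsub (b := R / 2) hs
    refine (key (by positivity) (hg.mono hs') fun x hx => hM x (hs' hx)).trans (le_of_eq ?_)
    field_simp; ring
  have hg' : DifferentiableOn ℂ (deriv g) (ball 0 R) := hg.deriv isOpen_ball
  have h2 : ∀ s ∈ ball (0 : ℂ) (R / 4), ‖deriv (deriv g) s‖ ≤ 32 * M / R ^ 2 := by
    intro s hs
    have hs' : ball s (R / 4) ⊆ ball 0 (R / 2) := by
      have := hsub (b := R / 4) hs
      rwa [show R / 4 + R / 4 = R / 2 by ring] at this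
    refine (key (by positivity) (hg'.mono (hs'.trans (ball_subset_ball (by linarith))))
      fun x hx => h1 x (hs' hx)).trans (le_of_eq ?_)
    field_simp; ring
  have hm : ∀ {s : ℂ}, s ∈ ball (0 : ℂ) (R / 4) → ball (0 : ℂ) R ∈ 𝓝 s := fun hs =>
    isOpen_ball.mem_nhds (ball_subset_ball (by linarith) hs)
  have h3 : ∀ s ∈ ball (0 : ℂ) (R / 4), ‖deriv g s - deriv g 0‖ ≤ 32 * M / R ^ 2 * ‖s‖ := by
    intro s hs
    have := (convex_ball (0 : ℂ) (R / 4)).norm_image_sub_le_of_norm_deriv_le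
      (fun x hx => hg'.differentiableAt (hm hx)) h2 (mem_ball_self (by positivity)) hs
    simpa using this
  have hcb : closedBall (0 : ℂ) ‖t‖ ⊆ ball 0 (R / 4) := closedBall_subset_ball ht
  have hdd : ∀ x ∈ closedBall (0 : ℂ) ‖t‖,
      HasDerivAt (fun s => g s - s • deriv g 0) (deriv g x - deriv g 0) x := by
    intro x hx
    have h := (hg.differentiableAt (hm (hcb hx))).hasDerivAt.fun_sub
      ((hasDerivAt_id x).smul_const (deriv g 0))
    simpa using h
  have := (convex_closedBall (0 : ℂ) ‖t‖).norm_image_sub_le_of_norm_deriv_le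
    (f := fun s => g s - s • deriv g 0) (x := 0) (y := t) (C := 32 * M / R ^ 2 * ‖t‖)
    (fun x hx => (hdd x hx).differentiableAt)
    (fun x hx => by
      rw [(hdd x hx).deriv]
      refine (h3 x (hcb hx)).trans ?_
      have : ‖x‖ ≤ ‖t‖ := by simpa using hx
      gcongr) (by simp) (by simp)
  have e : g t - t • deriv g 0 - (g 0 - (0 : ℂ) • deriv g 0) = g t - g 0 - t • deriv g 0 := by
    rw [zero_smul]; abel
  rw [e, sub_zero] at this
  linarith

/-- A directional derivative of a holomorphic map is a locally uniform limit of difference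
quotients, hence holomorphic. -/
lemma differentiableOn_fderiv_apply [CompleteSpace F] {U : Set E} (hU : IsOpen U) {f : E → F}
    (hf : DifferentiableOn ℂ f U) (v : E) : DifferentiableOn ℂ (fun z => fderiv ℂ f z v) U := by
  intro z hz
  have hc : ContinuousAt f z := (hf.differentiableAt (hU.mem_nhds hz)).continuousAt
  obtain ⟨r, hr, hball⟩ : ∃ r > 0, ∀ x ∈ ball z r, x ∈ U ∧ ‖f x‖ ≤ ‖f z‖ + 1 := by
    have h1 : ∀ᶠ x in 𝓝 z, ‖f x‖ < ‖f z‖ + 1 :=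
      hc.norm.eventually_lt continuousAt_const (by simp)
    obtain ⟨r, hr, h⟩ := Metric.eventually_nhds_iff_ball.1 ((hU.eventually_mem hz).and h1)
    exact ⟨r, hr, fun x hx => ⟨(h x hx).1, (h x hx).2.le⟩⟩
  set M := ‖f z‖ + 1
  -- On `ball z (r / 2)` the map `t ↦ f (x + t v)` is defined and bounded for `‖t‖ < R`.
  obtain ⟨R, hR, hRv⟩ : ∃ R > 0, R * ‖v‖ ≤ r / 2 := by
    refine ⟨r / 2 / (‖v‖ + 1), by positivity, ?_⟩
    rw [div_mul_eq_mul_div, div_le_iff₀ (by positivity)]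
    nlinarith [norm_nonneg v]
  have hsub : ∀ x ∈ ball z (r / 2), ball x (r / 2) ⊆ ball z r := by
    intro x hx
    refine ball_subset_ball' ?_
    rw [mem_ball] at hx
    linarith
  -- The step `1 / (n + N)` of the difference quotients is less than `R / 4` from `n = 0` on.
  obtain ⟨N, hN⟩ := exists_nat_gt (4 / R)
  have hNpos : (0 : ℝ) < N := lt_trans (by positivity) hN
  let c : ℕ → ℂ := fun n => (((n + N : ℕ) : ℝ) : ℂ)
  have hcn : ∀ n, ‖(c n)⁻¹‖ = 1 / (n + N : ℝ) := by
    intro n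
    simp only [c, norm_inv, Complex.norm_real, Real.norm_eq_abs, one_div]
    rw [abs_of_nonneg (by positivity)]; push_cast; rfl
  have hcpos : ∀ n : ℕ, (0 : ℝ) < n + N := fun n => by positivity
  have hc0 : ∀ n, c n ≠ 0 := fun n => by
    have := hcpos n
    simp only [c, ne_eq, Complex.ofReal_eq_zero]
    push_cast; exact this.ne'
  have hcR : ∀ n, ‖(c n)⁻¹‖ < R / 4 := by
    intro n
    rw [hcn, div_lt_iff₀ (hcpos n)]
    rw [div_lt_iff₀ hR] at hN
    nlinarith [(Nat.cast_nonneg n : (0 : ℝ) ≤ n)]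
  have hin : ∀ n, ∀ x ∈ ball z (r / 2), x + (c n)⁻¹ • v ∈ ball z r := fun n x hx =>
    hsub x hx (add_smul_mem_ball (by positivity) hRv ((hcR n).trans (by linarith)))
  have main : DifferentiableOn ℂ (fun z => fderiv ℂ f z v) (ball z (r / 2)) := by
    refine differentiableOn_of_tendstoLocallyUniformlyOn isOpen_ball
      (f := fun n x => c n • (f (x + (c n)⁻¹ • v) - f x)) (fun n => ?_) fun y hy => ?_
    · refine DifferentiableOn.const_smul (DifferentiableOn.sub ?_ ?_) _
      · exact hf.comp (by fun_prop) fun x hx => (hball _ (hin n x hx)).1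
      · exact hf.mono fun x hx => (hball x (ball_subset_ball (by linarith) hx)).1
    · obtain ⟨ρ, hρ, hρs⟩ := isOpen_iff.1 isOpen_ball y hy
      refine ⟨ρ, hρ, TendstoUniformlyOn.mono ?_ hρs⟩
      rw [Metric.tendstoUniformlyOn_iff]
      intro ε hε
      have hlim : Tendsto (fun n : ℕ => 32 * M / R ^ 2 * (1 / (n + N : ℝ))) atTop (𝓝 0) := by
        have : Tendsto (fun n : ℕ => (n + N : ℝ)) atTop atTop :=
          tendsto_atTop_add_const_right _ _ tendsto_natCast_atTop_atTop
        simpa using (this.inv_tendsto_atTop).const_mul (32 * M / R ^ 2)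
      filter_upwards [hlim.eventually_lt_const hε] with n hn x hx
      have hxU : x ∈ U := (hball x (ball_subset_ball (by linarith) hx)).1
      have hT := norm_taylor_remainder_le hR (differentiableOn_line (by positivity)
        (hf.mono fun y hy => (hball y (hsub x hx hy)).1) hRv) (M := M)
        (fun t ht => (hball _ (hsub x hx (add_smul_mem_ball (by positivity) hRv
          (mem_ball_zero_iff.1 ht)))).2) (hcR n)
      rw [deriv_line (hf.differentiableAt (hU.mem_nhds hxU)), zero_smul, add_zero] at hT
      have e : fderiv ℂ f x v - c n • (f (x + (c n)⁻¹ • v) - f x)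
          = -(c n • (f (x + (c n)⁻¹ • v) - f x - (c n)⁻¹ • fderiv ℂ f x v)) := by
        rw [smul_sub (c n) _ ((c n)⁻¹ • _), smul_inv_smul₀ (hc0 n)]; abel
      rw [dist_eq_norm, e, norm_neg, norm_smul]
      have hcm : ‖c n‖ * ‖(c n)⁻¹‖ = 1 := by
        rw [← norm_mul, mul_inv_cancel₀ (hc0 n), norm_one]
      calc ‖c n‖ * _ ≤ ‖c n‖ * (32 * M / R ^ 2 * ‖(c n)⁻¹‖ ^ 2) := by gcongr
        _ = 32 * M / R ^ 2 * ((‖c n‖ * ‖(c n)⁻¹‖) * ‖(c n)⁻¹‖) := by ring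
        _ = 32 * M / R ^ 2 * (1 / (n + N : ℝ)) := by rw [hcm, one_mul, hcn]
        _ < ε := hn
  exact (main.differentiableAt (ball_mem_nhds z (by positivity))).differentiableWithinAt

end Holomorphic

section Coordinates

variable {d : ℕ} {F : Type*} [NormedAddCommGroup F] [NormedSpace ℂ F] [CompleteSpace F]

lemma differentiableOn_fderiv {U : Set (Fin d → ℂ)} (hU : IsOpen U) {f : (Fin d → ℂ) → F}
    (hf : DifferentiableOn ℂ f U) : DifferentiableOn ℂ (fderiv ℂ f) U := by
  have e : fderiv ℂ f = fun z => ∑ i, (ContinuousLinearMap.smulRightL ℂ (Fin d → ℂ) F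
      (ContinuousLinearMap.proj i)) (fderiv ℂ f z (Pi.single i 1)) := by
    funext z
    ext v
    conv_lhs => rw [← Finset.univ_sum_single v]
    simp only [map_sum, sum_apply]
    refine Finset.sum_congr rfl fun i _ => ?_
    have : Pi.single i (v i) = v i • (Pi.single i 1 : Fin d → ℂ) := by
      rw [← Pi.single_smul]; simp
    rw [this, map_smul]
    simp
  rw [e]
  refine DifferentiableOn.fun_sum fun i _ => ?_
  exact (ContinuousLinearMap.differentiable _).comp_differentiableOn
    (differentiableOn_fderiv_apply hU hf _)

/-- Holomorphic maps of several variables are smooth. -/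
lemma contDiffOn_of_differentiableOn {U : Set (Fin d → ℂ)} (hU : IsOpen U)
    {f : (Fin d → ℂ) → F} (hf : DifferentiableOn ℂ f U) (n : ℕ) : ContDiffOn ℂ n f U := by
  induction n generalizing F with
  | zero => exact contDiffOn_zero.2 hf.continuousOn
  | succ n ih =>
    push_cast
    rw [contDiffOn_succ_iff_fderiv_of_isOpen hU]
    exact ⟨hf, fun h => absurd h (by simp), ih (differentiableOn_fderiv hU hf)⟩

end Coordinates

/-- A locally bounded family of functionals that depends holomorphically on the parameter when
tested on each vector is holomorphic as a map into the dual space. -/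
lemma differentiableOn_dual {E H : Type*} [NormedAddCommGroup E] [NormedSpace ℂ E]
    [NormedAddCommGroup H] [NormedSpace ℂ H] {U : Set E} (hU : IsOpen U) {φ : E → (H →L[ℂ] ℂ)}
    (hφ : ∀ f, DifferentiableOn ℂ (fun z => φ z f) U)
    (hb : ∀ z ∈ U, ∃ r > 0, ∃ M, ∀ x ∈ ball z r, ‖φ x‖ ≤ M) : DifferentiableOn ℂ φ U := by
  intro z hz
  obtain ⟨r₁, hr₁, M, hM⟩ := hb z hz
  obtain ⟨r₂, hr₂, hr₂U⟩ := isOpen_iff.1 hU z hz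
  set r := min r₁ r₂
  have hr : 0 < r := by positivity
  have hM0 : 0 ≤ M := (norm_nonneg _).trans (hM z (mem_ball_self hr₁))
  have hd : ∀ f, DifferentiableOn ℂ (fun z => φ z f) (ball z r) := fun f =>
    (hφ f).mono ((ball_subset_ball (min_le_right _ _)).trans hr₂U)
  have hdz : ∀ f, DifferentiableAt ℂ (fun z => φ z f) z := fun f =>
    (hd f).differentiableAt (ball_mem_nhds z hr)
  have hbd : ∀ f, ∀ x ∈ ball z r, ‖φ x f‖ ≤ M * ‖f‖ := fun f x hx =>
    (φ x).le_of_opNorm_le (hM x (ball_subset_ball (min_le_left _ _) hx)) f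
  let L₀ : E →ₗ[ℂ] H →ₗ[ℂ] ℂ := LinearMap.mk₂ ℂ (fun h f => fderiv ℂ (fun z => φ z f) z h)
    (fun h h' f => map_add _ _ _) (fun c h f => map_smul _ _ _)
    (fun h f f' => by
      have : (fun z => φ z (f + f')) = (fun z => φ z f) + fun z => φ z f' := by
        funext x; simp
      rw [this, fderiv_add (hdz f) (hdz f')]; rfl)
    (fun c h f => by
      have : (fun z => φ z (c • f)) = c • fun z => φ z f := by
        funext x; simp
      rw [this, fderiv_const_smul (hdz f)]; rfl)
  let L : E →L[ℂ] H →L[ℂ] ℂ := L₀.mkContinuous₂ (2 * M / r) fun h f => by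
    have := norm_fderiv_le_of_bound hr (hd f) (hbd f)
    calc ‖fderiv ℂ (fun z => φ z f) z h‖ ≤ 2 * (M * ‖f‖) / r * ‖h‖ :=
          ContinuousLinearMap.le_of_opNorm_le _ this h
      _ = 2 * M / r * ‖h‖ * ‖f‖ := by ring
  suffices HasFDerivAt φ L z from this.differentiableAt.differentiableWithinAt
  rw [hasFDerivAt_iff_isLittleO_nhds_zero]
  have hO : (fun h => φ (z + h) - φ z - L h) =O[𝓝 0] fun h : E => ‖h‖ ^ 2 := by
    refine Asymptotics.IsBigO.of_bound (32 * M / r ^ 2) ?_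
    filter_upwards [ball_mem_nhds (0 : E) (show 0 < r / 8 by positivity)] with h hh
    rw [mem_ball_zero_iff] at hh
    refine ContinuousLinearMap.opNorm_le_bound _ (by positivity) fun f => ?_
    rcases eq_or_ne h 0 with rfl | h0
    · simp
    have hh0 : 0 < ‖h‖ := norm_pos_iff.2 h0
    have hRv : r / ‖h‖ * ‖h‖ ≤ r := by field_simp; rfl
    -- The line `t ↦ z + t h` stays in the ball for `‖t‖ < r / ‖h‖`, and `t = 1` is well inside.
    have hT := norm_taylor_remainder_le (g := fun t : ℂ => φ (z + t • h) f)
      (R := r / ‖h‖) (M := M * ‖f‖) (t := 1) (by positivity)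
      (differentiableOn_line hr (hd f) hRv)
      (fun t ht => hbd f _ (add_smul_mem_ball hr hRv (mem_ball_zero_iff.1 ht)))
      (by rw [norm_one, lt_div_iff₀ (by norm_num), lt_div_iff₀ hh0]; linarith)
    rw [deriv_line (f := fun z => φ z f) (hdz f)] at hT
    simp only [one_smul, zero_smul, add_zero, norm_one, one_pow, mul_one] at hT
    have : ((φ (z + h) - φ z - L h) f) = φ (z + h) f - φ z f - fderiv ℂ (fun z => φ z f) z h :=
      rfl
    rw [this]
    refine hT.trans (le_of_eq ?_)
    rw [norm_pow, norm_norm]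
    field_simp
  exact hO.trans_isLittleO (by
    simpa using Asymptotics.isLittleO_norm_pow_id (E' := E) (one_lt_two))

/-! ### The mean value property over polydiscs -/

lemma measurePreserving_circle_smul (d : ℕ) {c : ℂ} (hc : ‖c‖ = 1) :
    MeasurePreserving (fun v : Fin d → ℂ => c • v) volume volume := by
  have h : ∀ _ : Fin d, MeasurePreserving (fun x : ℂ => c * x) volume volume := fun _ =>
    (rotation ⟨c, mem_sphere_zero_iff_norm.2 hc⟩).measurePreserving
  exact volume_preserving_pi h

lemma setIntegral_closedBall_smul {d : ℕ} {c : ℂ} (hc : ‖c‖ = 1) (r : ℝ)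
    (f : (Fin d → ℂ) → ℂ) :
    ∫ v in closedBall 0 r, f (c • v) = ∫ v in closedBall 0 r, f v := by
  have hc0 : c ≠ 0 := by rintro rfl; simp at hc
  have hemb : MeasurableEmbedding (fun v : Fin d → ℂ => c • v) :=
    (Homeomorph.smulOfNeZero c hc0).measurableEmbedding
  have := (measurePreserving_circle_smul d hc).setIntegral_preimage_emb hemb f (closedBall 0 r)
  rw [← this]
  congr 2
  ext v
  simp [norm_smul, hc]

/-- The value of a holomorphic function at the centre of a polydisc is its mean over the
polydisc: each circle mean over `θ ↦ z + e^{iθ} v` gives `f z`, and the Lebesgue measure is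
invariant under `v ↦ e^{iθ} v`. -/
lemma setIntegral_closedBall_eq {d : ℕ} {f : (Fin d → ℂ) → ℂ} {z : Fin d → ℂ} {r R : ℝ}
    (hr : 0 ≤ r) (hrR : r < R) (hf : DifferentiableOn ℂ f (ball z R)) :
    ∫ v in closedBall 0 r, f (z + v) = volume.real (closedBall (0 : Fin d → ℂ) r) • f z := by
  have hin : ∀ v ∈ closedBall (0 : Fin d → ℂ) r, ∀ t : ℂ, ‖t‖ ≤ 1 → z + t • v ∈ ball z R := by
    intro v hv t ht
    rw [mem_closedBall_zero_iff] at hv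
    rw [mem_ball_iff_norm, add_sub_cancel_left, norm_smul]
    nlinarith [norm_nonneg v, norm_nonneg t]
  have hcirc : ∀ v ∈ closedBall (0 : Fin d → ℂ) r,
      ∫ θ in (0)..2 * Real.pi, f (z + circleMap 0 1 θ • v) = (2 * Real.pi) • f z := by
    intro v hv
    have hd : DiffContOnCl ℂ (fun t : ℂ => f (z + t • v)) (ball 0 |1|) := by
      refine DifferentiableOn.diffContOnCl (hf.comp (by fun_prop) fun t ht => ?_)
      have := closure_ball_subset_closedBall ht
      exact hin v hv t (by simpa using this)
    have := hd.circleAverage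
    simp only [Real.circleAverage, zero_smul, add_zero] at this
    rw [← this, smul_inv_smul₀ (by positivity)]
  have hint : Integrable (Function.uncurry fun (θ : ℝ) (v : Fin d → ℂ) =>
      f (z + circleMap 0 1 θ • v))
      ((volume.restrict (Set.Ioc 0 (2 * Real.pi))).prod (volume.restrict (closedBall 0 r))) := by
    rw [Measure.prod_restrict]
    have hcpt : IsCompact (Set.Icc (0 : ℝ) (2 * Real.pi) ×ˢ closedBall (0 : Fin d → ℂ) r) :=
      isCompact_Icc.prod (isCompact_closedBall _ _)
    have hcont : ContinuousOn (Function.uncurry fun (θ : ℝ) (v : Fin d → ℂ) =>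
        f (z + circleMap 0 1 θ • v)) (Set.Icc (0 : ℝ) (2 * Real.pi) ×ˢ closedBall 0 r) := by
      refine hf.continuousOn.comp (by fun_prop) fun p hp => hin p.2 hp.2 _ ?_
      simp
    exact (hcont.integrableOn_compact hcpt).mono_set
      (Set.prod_mono Set.Ioc_subset_Icc_self subset_rfl)
  have hswap := integral_integral_swap hint
  have h1 : ∫ θ in Set.Ioc 0 (2 * Real.pi), ∫ v in closedBall (0 : Fin d → ℂ) r,
      f (z + circleMap 0 1 θ • v) = (2 * Real.pi) • ∫ v in closedBall 0 r, f (z + v) := by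
    have : ∀ θ : ℝ, ∫ v in closedBall (0 : Fin d → ℂ) r, f (z + circleMap 0 1 θ • v)
        = ∫ v in closedBall 0 r, f (z + v) := fun θ =>
      setIntegral_closedBall_smul (by simp) r fun v => f (z + v)
    simp_rw [this]
    simp [Real.pi_pos.le]
  have h2 : ∫ v in closedBall (0 : Fin d → ℂ) r, ∫ θ in Set.Ioc 0 (2 * Real.pi),
      f (z + circleMap 0 1 θ • v)
      = (2 * Real.pi) • (volume.real (closedBall (0 : Fin d → ℂ) r) • f z) := by
    rw [setIntegral_congr_fun (g := fun _ => (2 * Real.pi) • f z) measurableSet_closedBall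
      fun v hv => ?_]
    · rw [setIntegral_const, smul_comm]
    · rw [← hcirc v hv, intervalIntegral.integral_of_le (by positivity)]
  rw [h1, h2] at hswap
  exact smul_right_injective ℂ (by positivity : (2 * Real.pi) ≠ 0) hswap

/-- Point evaluations are bounded in the `L²` norm: apply the mean value property to `f²`. -/
lemma volume_mul_sq_norm_le {d : ℕ} {Ω : Set (Fin d → ℂ)}
    {f : (Fin d → ℂ) → ℂ} {z : Fin d → ℂ} {r R : ℝ} (hr : 0 ≤ r) (hrR : r < R)
    (hR : ball z R ⊆ Ω) (hf : DifferentiableOn ℂ f Ω) (hL : MemLp f 2 (volume.restrict Ω)) :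
    volume.real (closedBall (0 : Fin d → ℂ) r) * ‖f z‖ ^ 2 ≤ ∫ x in Ω, ‖f x‖ ^ 2 := by
  have hmv := setIntegral_closedBall_eq hr hrR (f := fun x => f x ^ 2) ((hf.mono hR).pow 2)
  have hint : IntegrableOn (fun x => ‖f x‖ ^ 2) Ω := (memLp_two_iff_integrable_sq_norm hL.1).1 hL
  have hnn : 0 ≤ volume.real (closedBall (0 : Fin d → ℂ) r) := measureReal_nonneg
  calc volume.real (closedBall (0 : Fin d → ℂ) r) * ‖f z‖ ^ 2
      = ‖∫ v in closedBall (0 : Fin d → ℂ) r, f (z + v) ^ 2‖ := by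
        rw [hmv, norm_smul, norm_pow, Real.norm_of_nonneg hnn]
    _ ≤ ∫ v in closedBall (0 : Fin d → ℂ) r, ‖f (z + v)‖ ^ 2 := by
        refine (norm_integral_le_integral_norm _).trans (le_of_eq ?_)
        simp
    _ = ∫ x in closedBall z r, ‖f x‖ ^ 2 := by
        have := (measurePreserving_add_left volume z).setIntegral_preimage_emb
          (measurableEmbedding_addLeft z) (fun x => ‖f x‖ ^ 2) (closedBall z r)
        rw [← this]
        congr 2
        ext v
        simp
    _ ≤ ∫ x in Ω, ‖f x‖ ^ 2 :=
        setIntegral_mono_set hint (ae_of_all _ fun x => by positivity)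
          ((closedBall_subset_ball hrR).trans hR).eventuallyLE

/-! ### The Bergman space as a Hilbert space of holomorphic functions -/

/-- The Bergman space of `Ω` as a subspace of `L²(Ω)`: the classes that have a holomorphic
representative. -/
noncomputable def bergmanSpace {d : ℕ} (Ω : Set (Fin d → ℂ)) :
    Submodule ℂ (Lp ℂ 2 ((volume : Measure (Fin d → ℂ)).restrict Ω)) where
  carrier := {F | ∃ f, DifferentiableOn ℂ f Ω ∧ F =ᵐ[volume.restrict Ω] f}
  add_mem' := by
    rintro F G ⟨f, hf, hFf⟩ ⟨g, hg, hGg⟩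
    exact ⟨f + g, hf.add hg, (Lp.coeFn_add F G).trans (hFf.add hGg)⟩
  zero_mem' := ⟨0, differentiableOn_const 0, Lp.coeFn_zero _ _ _⟩
  smul_mem' := by
    rintro c F ⟨f, hf, hFf⟩
    exact ⟨c • f, hf.const_smul c, (Lp.coeFn_smul c F).trans (hFf.const_smul c)⟩

/-- The holomorphic representative of an element of the Bergman space. -/
noncomputable def holRep {d : ℕ} {Ω : Set (Fin d → ℂ)} (F : bergmanSpace Ω) :
    (Fin d → ℂ) → ℂ :=
  F.2.choose

section

variable {d : ℕ} {Ω : Set (Fin d → ℂ)}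

lemma differentiableOn_holRep (F : bergmanSpace Ω) : DifferentiableOn ℂ (holRep F) Ω :=
  F.2.choose_spec.1

lemma coeFn_ae_eq_holRep (F : bergmanSpace Ω) : F.1 =ᵐ[volume.restrict Ω] holRep F :=
  F.2.choose_spec.2

lemma memBergman_holRep (F : bergmanSpace Ω) : MemBergman Ω (holRep F) :=
  ⟨differentiableOn_holRep F, (Lp.memLp F.1).ae_eq (coeFn_ae_eq_holRep F)⟩

lemma holRep_eqOn (hΩ : IsOpen Ω) (F : bergmanSpace Ω) {f : (Fin d → ℂ) → ℂ}
    (hf : DifferentiableOn ℂ f Ω) (hFf : F.1 =ᵐ[volume.restrict Ω] f) :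
    Set.EqOn (holRep F) f Ω :=
  Measure.eqOn_open_of_ae_eq ((coeFn_ae_eq_holRep F).symm.trans hFf) hΩ
    (differentiableOn_holRep F).continuousOn hf.continuousOn

/-- The element of the Bergman space given by a square integrable holomorphic function. -/
noncomputable def MemBergman.toSpace {f : (Fin d → ℂ) → ℂ} (hf : MemBergman Ω f) :
    bergmanSpace Ω :=
  ⟨hf.2.toLp f, f, hf.1, hf.2.coeFn_toLp⟩

lemma MemBergman.holRep_toSpace (hΩ : IsOpen Ω) {f : (Fin d → ℂ) → ℂ} (hf : MemBergman Ω f) :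
    Set.EqOn (holRep hf.toSpace) f Ω :=
  holRep_eqOn hΩ _ hf.1 hf.2.coeFn_toLp

lemma norm_sq_eq_setIntegral (F : bergmanSpace Ω) : ‖F‖ ^ 2 = ∫ x in Ω, ‖holRep F x‖ ^ 2 := by
  have h1 : inner ℂ F.1 F.1 = ((‖F‖ ^ 2 : ℝ) : ℂ) := by
    rw [inner_self_eq_norm_sq_to_K]; push_cast; rfl
  rw [L2.inner_def] at h1
  have h2 : ∫ x in Ω, inner ℂ (F.1 x) (F.1 x) = ((∫ x in Ω, ‖holRep F x‖ ^ 2 : ℝ) : ℂ) := by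
    rw [← integral_complex_ofReal]
    refine integral_congr_ae ?_
    filter_upwards [coeFn_ae_eq_holRep F] with x hx
    rw [hx, inner_self_eq_norm_sq_to_K]; push_cast; rfl
  rw [h2] at h1
  exact_mod_cast h1.symm

lemma norm_holRep_le {z : Fin d → ℂ} {r R : ℝ} (hr : 0 < r) (hrR : r < R) (hR : ball z R ⊆ Ω)
    (F : bergmanSpace Ω) :
    ‖holRep F z‖ ≤ (√(volume.real (closedBall (0 : Fin d → ℂ) r)))⁻¹ * ‖F‖ := by
  have hv : 0 < volume.real (closedBall (0 : Fin d → ℂ) r) :=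
    ENNReal.toReal_pos (measure_closedBall_pos _ _ hr).ne' (measure_closedBall_lt_top).ne
  have h := volume_mul_sq_norm_le hr.le hrR hR (differentiableOn_holRep F) (memBergman_holRep F).2
  rw [← norm_sq_eq_setIntegral] at h
  have hs : 0 < √(volume.real (closedBall (0 : Fin d → ℂ) r)) := Real.sqrt_pos.2 hv
  rw [inv_mul_eq_div, le_div_iff₀ hs]
  refine le_of_sq_le_sq ?_ (norm_nonneg _)
  rw [mul_pow, Real.sq_sqrt hv.le]
  linarith

lemma holRep_add (hΩ : IsOpen Ω) (F G : bergmanSpace Ω) :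
    Set.EqOn (holRep (F + G)) (holRep F + holRep G) Ω :=
  holRep_eqOn hΩ _ ((differentiableOn_holRep F).add (differentiableOn_holRep G))
    ((Lp.coeFn_add F.1 G.1).trans ((coeFn_ae_eq_holRep F).add (coeFn_ae_eq_holRep G)))

lemma holRep_smul (hΩ : IsOpen Ω) (c : ℂ) (F : bergmanSpace Ω) :
    Set.EqOn (holRep (c • F)) (c • holRep F) Ω :=
  holRep_eqOn hΩ _ ((differentiableOn_holRep F).const_smul c)
    ((Lp.coeFn_smul c F.1).trans ((coeFn_ae_eq_holRep F).const_smul c))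

open Classical in
/-- The evaluation `F ↦ F z` at a point of `Ω` (and `0` at points where it is not a bounded
functional). -/
noncomputable def evalBergman (Ω : Set (Fin d → ℂ)) (z : Fin d → ℂ) : bergmanSpace Ω →L[ℂ] ℂ :=
  if h : ∃ φ : bergmanSpace Ω →L[ℂ] ℂ, ∀ F, φ F = holRep F z then h.choose else 0

lemma evalBergman_apply (hΩ : IsOpen Ω) {z : Fin d → ℂ} (hz : z ∈ Ω) (F : bergmanSpace Ω) :
    evalBergman Ω z F = holRep F z := by
  have h : ∃ φ : bergmanSpace Ω →L[ℂ] ℂ, ∀ F, φ F = holRep F z := by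
    obtain ⟨R, hR, hRΩ⟩ := isOpen_iff.1 hΩ z hz
    refine ⟨LinearMap.mkContinuous
      { toFun := fun F => holRep F z
        map_add' := fun F G => holRep_add hΩ F G hz
        map_smul' := fun c F => holRep_smul hΩ c F hz } _
      (norm_holRep_le (half_pos hR) (half_lt_self hR) hRΩ), fun F => rfl⟩
  rw [evalBergman, dif_pos h]
  exact h.choose_spec F

lemma norm_evalBergman_le (hΩ : IsOpen Ω) {z : Fin d → ℂ} {r R : ℝ} (hr : 0 < r) (hrR : r < R)
    (hR : ball z R ⊆ Ω) :
    ‖evalBergman Ω z‖ ≤ (√(volume.real (closedBall (0 : Fin d → ℂ) r)))⁻¹ := by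
  refine ContinuousLinearMap.opNorm_le_bound _ (by positivity) fun F => ?_
  rw [evalBergman_apply hΩ (hR (mem_ball_self (hr.trans hrR)))]
  exact norm_holRep_le hr hrR hR F

lemma exists_norm_evalBergman_le (hΩ : IsOpen Ω) {z : Fin d → ℂ} (hz : z ∈ Ω) :
    ∃ r > 0, ∃ M, ∀ x ∈ ball z r, x ∈ Ω ∧ ‖evalBergman Ω x‖ ≤ M := by
  obtain ⟨R, hR, hRΩ⟩ := isOpen_iff.1 hΩ z hz
  refine ⟨R / 2, half_pos hR, _, fun x hx => ⟨hRΩ (ball_subset_ball (by linarith) hx),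
    norm_evalBergman_le hΩ (half_pos (half_pos hR)) (half_lt_self (half_pos hR)) ?_⟩⟩
  refine (ball_subset_ball' ?_).trans hRΩ
  rw [mem_ball] at hx
  linarith

lemma differentiableOn_evalBergman (hΩ : IsOpen Ω) : DifferentiableOn ℂ (evalBergman Ω) Ω := by
  refine differentiableOn_dual hΩ (fun F => ?_) fun z hz => ?_
  · exact (differentiableOn_holRep F).congr fun z hz => evalBergman_apply hΩ hz F
  · obtain ⟨r, hr, M, hM⟩ := exists_norm_evalBergman_le hΩ hz
    exact ⟨r, hr, M, fun x hx => (hM x hx).2⟩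

/-- The Bergman space is closed in `L²(Ω)`: convergence in `L²` implies locally uniform convergence
of the holomorphic representatives. -/
lemma isClosed_bergmanSpace (hΩ : IsOpen Ω) :
    IsClosed (bergmanSpace Ω : Set (Lp ℂ 2 ((volume : Measure (Fin d → ℂ)).restrict Ω))) := by
  refine IsSeqClosed.isClosed fun F G hF hFG => ?_
  let f : ℕ → bergmanSpace Ω := fun n => ⟨F n, hF n⟩
  have hcau : CauchySeq f := by
    have := hFG.cauchySeq
    rw [Metric.cauchySeq_iff] at this ⊢
    exact this
  have hunif : ∀ z ∈ Ω, ∃ r > 0, ball z r ⊆ Ω ∧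
      UniformCauchySeqOn (fun n => holRep (f n)) atTop (ball z r) := by
    intro z hz
    obtain ⟨r, hr, M, hM⟩ := exists_norm_evalBergman_le hΩ hz
    refine ⟨r, hr, fun x hx => (hM x hx).1, ?_⟩
    rw [Metric.uniformCauchySeqOn_iff]
    intro ε hε
    obtain ⟨N, hN⟩ := Metric.cauchySeq_iff.1 hcau (ε / (|M| + 1)) (by positivity)
    refine ⟨N, fun m hm n hn x hx => ?_⟩
    rw [dist_eq_norm, ← evalBergman_apply hΩ (hM x hx).1, ← evalBergman_apply hΩ (hM x hx).1,
      ← map_sub]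
    have h1 := hN m hm n hn
    rw [dist_eq_norm, lt_div_iff₀ (by positivity)] at h1
    have h2 := (evalBergman Ω x).le_of_opNorm_le (hM x hx).2 (f m - f n)
    nlinarith [norm_nonneg (f m - f n), le_abs_self M]
  have hlim : ∀ z ∈ Ω, ∃ L, Tendsto (fun n => holRep (f n) z) atTop (𝓝 L) := by
    intro z hz
    obtain ⟨r, hr, -, h⟩ := hunif z hz
    exact cauchySeq_tendsto_of_complete (h.cauchySeq (mem_ball_self hr))
  choose! g hg using hlim
  refine ⟨g, ?_, ?_⟩
  · refine differentiableOn_of_tendstoLocallyUniformlyOn hΩ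
      (fun n => differentiableOn_holRep (f n)) fun z hz => ?_
    obtain ⟨r, hr, hrΩ, h⟩ := hunif z hz
    exact ⟨r, hr, h.tendstoUniformlyOn_of_tendsto fun x hx => hg x (hrΩ hx)⟩
  · obtain ⟨ns, hns, hae⟩ := (tendstoInMeasure_of_tendsto_Lp hFG).exists_seq_tendsto_ae
    have hall : ∀ᵐ x ∂(volume.restrict Ω), ∀ n, F n x = holRep (f n) x :=
      ae_all_iff.2 fun n => coeFn_ae_eq_holRep (f n)
    filter_upwards [hae, hall, ae_restrict_mem hΩ.measurableSet] with x hx hall hxΩ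
    refine tendsto_nhds_unique hx ?_
    simp_rw [hall]
    exact (hg x hxΩ).comp hns.tendsto_atTop

lemma inner_bergmanSpace (F G : bergmanSpace Ω) :
    inner ℂ F G = ∫ x in Ω, holRep G x * conj (holRep F x) := by
  change inner ℂ F.1 G.1 = _
  rw [L2.inner_def]
  refine integral_congr_ae ?_
  filter_upwards [coeFn_ae_eq_holRep F, coeFn_ae_eq_holRep G] with x hx hy
  rw [hx, hy]
  simp

lemma exists_reproduces (hΩ : IsOpen Ω) {w : Fin d → ℂ} (hw : w ∈ Ω) :
    ∃ k : bergmanSpace Ω, Reproduces Ω w (holRep k) ∧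
      ∀ F : bergmanSpace Ω, inner ℂ k F = holRep F w := by
  have : CompleteSpace (bergmanSpace Ω) := (isClosed_bergmanSpace hΩ).completeSpace_coe
  set k := (InnerProductSpace.toDual ℂ (bergmanSpace Ω)).symm (evalBergman Ω w) with hk
  have hin : ∀ F : bergmanSpace Ω, inner ℂ k F = holRep F w := fun F => by
    rw [hk, InnerProductSpace.toDual_symm_apply, evalBergman_apply hΩ hw]
  refine ⟨k, ⟨memBergman_holRep k, fun f hf => ?_⟩, hin⟩
  rw [← hf.holRep_toSpace hΩ hw, ← hin, inner_bergmanSpace]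
  refine setIntegral_congr_fun hΩ.measurableSet fun x hx => ?_
  simp only [hf.holRep_toSpace hΩ hx]

/-- The reproducing element is unique as a function on `Ω`: by conjugate symmetry its value at `x`
is determined by a reproducing element for `x`. -/
lemma Reproduces.eqOn (hΩ : IsOpen Ω) {w : Fin d → ℂ} {k₁ k₂ : (Fin d → ℂ) → ℂ}
    (h₁ : Reproduces Ω w k₁) (h₂ : Reproduces Ω w k₂) : Set.EqOn k₁ k₂ Ω := by
  intro x hx
  obtain ⟨k, hk, -⟩ := exists_reproduces hΩ hx
  have key : ∀ {l}, Reproduces Ω w l → l x = conj (holRep k w) := by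
    intro l hl
    rw [← hk.2 l hl.1, ← hl.2 _ hk.1, ← integral_conj]
    simp [mul_comm]
  rw [key h₁, key h₂]

lemma Reproduces.bergmanKernel_eq (hΩ : IsOpen Ω) {z w : Fin d → ℂ} (hz : z ∈ Ω)
    {k : (Fin d → ℂ) → ℂ} (hk : Reproduces Ω w k) : bergmanKernel Ω z w = k z := by
  have h : ∃ k, Reproduces Ω w k := ⟨k, hk⟩
  rw [bergmanKernel, dif_pos h]
  exact h.choose_spec.eqOn hΩ hk hz

lemma reproduces_bergmanKernel (hΩ : IsOpen Ω) {w : Fin d → ℂ} (hw : w ∈ Ω) :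
    Reproduces Ω w fun z => bergmanKernel Ω z w := by
  obtain ⟨k, hk, -⟩ := exists_reproduces hΩ hw
  have h : ∃ k, Reproduces Ω w k := ⟨_, hk⟩
  have : (fun z => bergmanKernel Ω z w) = h.choose := by
    funext z
    rw [bergmanKernel, dif_pos h]
  rw [this]
  exact h.choose_spec

/-- The dual of a Hilbert space `G` is linearly isometric to a Hilbert space in such a way that the
Riesz isomorphism becomes a conjugate-linear isometry `C` of `G`: conjugation of the coordinates
with respect to an orthonormal basis. -/
lemma exists_dual_model (G : Type) [NormedAddCommGroup G] [InnerProductSpace ℂ G]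
    [CompleteSpace G] : ∃ (H : Type) (_ : NormedAddCommGroup H) (_ : InnerProductSpace ℂ H)
      (_ : CompleteSpace H) (C : G → H) (T : (G →L[ℂ] ℂ) →L[ℂ] H),
      (∀ φ x, inner ℂ (C x) (T φ) = φ x) ∧
      ∀ x φ, (∀ y, inner ℂ x y = φ y) → T φ = C x := by
  obtain ⟨s, b, -⟩ := exists_hilbertBasis ℂ G
  let S : lp (fun _ : s => ℂ) 2 ≃ₗᵢ⋆[ℂ] lp (fun _ : s => ℂ) 2 := starₗᵢ ℂ
  have hS : ∀ x i, S x i = star (x i) := fun x i => rfl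
  let C : G ≃ₗᵢ⋆[ℂ] lp (fun _ : s => ℂ) 2 := b.repr.trans S
  have hC : ∀ x y, inner ℂ (C x) (C y) = inner ℂ y x := by
    intro x y
    rw [← b.repr.inner_map_map, lp.inner_eq_tsum, lp.inner_eq_tsum]
    refine tsum_congr fun i => ?_
    simp only [C]
    rw [LinearIsometryEquiv.trans_apply, LinearIsometryEquiv.trans_apply, hS, hS]
    simp [mul_comm]
  let T : (G →L[ℂ] ℂ) ≃ₗᵢ[ℂ] lp (fun _ : s => ℂ) 2 := (InnerProductSpace.toDual ℂ G).symm.trans C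
  have hT : ∀ φ, T φ = C ((InnerProductSpace.toDual ℂ G).symm φ) := fun _ => rfl
  refine ⟨lp (fun _ : s => ℂ) 2, inferInstance, inferInstance, inferInstance, C,
    T.toContinuousLinearEquiv, fun φ x => ?_, fun x φ h => ?_⟩
  · change inner ℂ (C x) (T φ) = φ x
    rw [hT, hC, InnerProductSpace.toDual_symm_apply]
  · change T φ = C x
    rw [hT]
    congr 1
    refine ext_inner_right ℂ fun y => ?_
    rw [InnerProductSpace.toDual_symm_apply, h]

/-- The **Bergman–Kobayashi map**: a holomorphic map `k` of `Ω` into a Hilbert space with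
`K(z, w) = ⟨k(w), k(z)⟩`, namely `z ↦ (e_i(z))_i` for an orthonormal basis `(e_i)` of the Bergman
space. Every function of the Bergman space is of the form `z ↦ ⟨a, k(z)⟩`. -/
theorem exists_bergman_map (hΩ : IsOpen Ω) :
    ∃ (H : Type) (_ : NormedAddCommGroup H) (_ : InnerProductSpace ℂ H) (_ : CompleteSpace H)
      (k : (Fin d → ℂ) → H), DifferentiableOn ℂ k Ω ∧
      (∀ z ∈ Ω, ∀ w ∈ Ω, bergmanKernel Ω z w = inner ℂ (k w) (k z)) ∧
      ∀ f, MemBergman Ω f → ∃ a, ∀ z ∈ Ω, inner ℂ a (k z) = f z := by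
  have : CompleteSpace (bergmanSpace Ω) := (isClosed_bergmanSpace hΩ).completeSpace_coe
  obtain ⟨H, i₁, i₂, i₃, C, T, hCT, hT⟩ := exists_dual_model (bergmanSpace Ω)
  refine ⟨H, i₁, i₂, i₃, fun z => T (evalBergman Ω z),
    T.differentiable.comp_differentiableOn (differentiableOn_evalBergman hΩ),
    fun z hz w hw => ?_, fun f hf => ⟨C hf.toSpace, fun z hz => ?_⟩⟩
  · obtain ⟨κ, hκ, hκ'⟩ := exists_reproduces hΩ hw
    beta_reduce
    rw [hκ.bergmanKernel_eq hΩ hz, hT κ (evalBergman Ω w) fun F => by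
      rw [hκ', evalBergman_apply hΩ hw], hCT, evalBergman_apply hΩ hz]
  · rw [hCT, evalBergman_apply hΩ hz, hf.holRep_toSpace hΩ hz]

lemma memBergman_of_differentiable (hΩ : IsOpen Ω) (hb : Bornology.IsBounded Ω)
    {f : (Fin d → ℂ) → ℂ} (hf : Differentiable ℂ f) : MemBergman Ω f := by
  have hc : IsCompact (closure Ω) := hb.isCompact_closure
  obtain ⟨C, hC⟩ := hc.exists_bound_of_continuousOn hf.continuous.continuousOn
  have : IsFiniteMeasure ((volume : Measure (Fin d → ℂ)).restrict Ω) :=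
    isFiniteMeasure_restrict.2 hb.measure_lt_top.ne
  refine ⟨hf.differentiableOn, MemLp.of_bound hf.continuous.aestronglyMeasurable C ?_⟩
  filter_upwards [ae_restrict_mem hΩ.measurableSet] with x hx
  exact hC x (subset_closure hx)

end

/-! ### Wirtinger calculus -/

/-- `f` is real-differentiable at `p` with differential `∑ (a_i dz_i + b_i dz̄_i)`, that is,
with Wirtinger derivatives `∂f/∂z_i = a_i` and `∂f/∂z̄_i = b_i`. -/
def HasWirtingerAt {n : ℕ} (f : (Fin n → ℂ) → ℂ) (a b : Fin n → ℂ) (p : Fin n → ℂ) : Prop :=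
  ∃ L : (Fin n → ℂ) →L[ℝ] ℂ, HasFDerivAt f L p ∧
    ∀ v, L v = ∑ i, (a i * v i + b i * conj (v i))

section Wirtinger

variable {n : ℕ} {f g : (Fin n → ℂ) → ℂ} {a b a' b' p : Fin n → ℂ}

lemma HasWirtingerAt.dz (h : HasWirtingerAt f a b p) (i : Fin n) : dz i f p = a i := by
  obtain ⟨L, hL, hv⟩ := h
  have h1 : L (Pi.single i 1) = a i + b i := by
    rw [hv, Finset.sum_eq_single i (fun j _ hj => by simp [hj]) (by simp)]
    simp
  have h2 : L (Pi.single i Complex.I) = a i * Complex.I - b i * Complex.I := by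
    rw [hv, Finset.sum_eq_single i (fun j _ hj => by simp [hj]) (by simp)]
    simp [sub_eq_add_neg]
  rw [CartanHartogs.dz, hL.fderiv, h1, h2]
  linear_combination (-(a i - b i) / 2) * Complex.I_sq

lemma HasWirtingerAt.dzbar (h : HasWirtingerAt f a b p) (i : Fin n) : dzbar i f p = b i := by
  obtain ⟨L, hL, hv⟩ := h
  have h1 : L (Pi.single i 1) = a i + b i := by
    rw [hv, Finset.sum_eq_single i (fun j _ hj => by simp [hj]) (by simp)]
    simp
  have h2 : L (Pi.single i Complex.I) = a i * Complex.I - b i * Complex.I := by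
    rw [hv, Finset.sum_eq_single i (fun j _ hj => by simp [hj]) (by simp)]
    simp [sub_eq_add_neg]
  rw [CartanHartogs.dzbar, hL.fderiv, h1, h2]
  linear_combination ((a i - b i) / 2) * Complex.I_sq

lemma _root_.DifferentiableAt.hasWirtingerAt (hf : DifferentiableAt ℝ f p) :
    HasWirtingerAt f (fun i => CartanHartogs.dz i f p) (fun i => CartanHartogs.dzbar i f p) p := by
  refine ⟨_, hf.hasFDerivAt, fun v => ?_⟩
  conv_lhs => rw [← Finset.univ_sum_single v]
  rw [map_sum]
  refine Finset.sum_congr rfl fun i _ => ?_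
  have hv : (Pi.single i (v i) : Fin n → ℂ)
      = (v i).re • (Pi.single i 1 : Fin n → ℂ)
        + (v i).im • (Pi.single i Complex.I : Fin n → ℂ) := by
    rw [← Pi.single_smul, ← Pi.single_smul, ← Pi.single_add]
    congr 1
    simp
  rw [hv, map_add, map_smul, map_smul, Complex.real_smul, Complex.real_smul]
  simp only [CartanHartogs.dz, CartanHartogs.dzbar]
  have h1 := Complex.re_add_im (v i)
  have h2 : conj (v i) = (v i).re - (v i).im * Complex.I := by
    apply Complex.ext <;> simp
  rw [h2]
  nth_rewrite 3 [← h1]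
  linear_combination ((v i).im * fderiv ℝ f p (Pi.single i Complex.I)) * Complex.I_sq

lemma HasWirtingerAt.differentiableAt (h : HasWirtingerAt f a b p) : DifferentiableAt ℝ f p := by
  obtain ⟨L, hL, -⟩ := h
  exact hL.differentiableAt

lemma HasWirtingerAt.congr (h : HasWirtingerAt f a b p) (hfg : g =ᶠ[𝓝 p] f) :
    HasWirtingerAt g a b p := by
  obtain ⟨L, hL, hv⟩ := h
  exact ⟨L, hL.congr_of_eventuallyEq hfg, hv⟩

lemma hasWirtingerAt_const (c : ℂ) : HasWirtingerAt (fun _ => c) 0 0 p :=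
  ⟨0, hasFDerivAt_const c p, fun v => by simp⟩

lemma HasWirtingerAt.add (hf : HasWirtingerAt f a b p) (hg : HasWirtingerAt g a' b' p) :
    HasWirtingerAt (fun q => f q + g q) (fun i => a i + a' i) (fun i => b i + b' i) p := by
  obtain ⟨L, hL, hv⟩ := hf
  obtain ⟨L', hL', hv'⟩ := hg
  refine ⟨_, hL.add hL', fun v => ?_⟩
  rw [add_apply, hv, hv', ← Finset.sum_add_distrib]
  exact Finset.sum_congr rfl fun i _ => by ring

lemma HasWirtingerAt.mul (hf : HasWirtingerAt f a b p) (hg : HasWirtingerAt g a' b' p) :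
    HasWirtingerAt (fun q => f q * g q) (fun i => f p * a' i + g p * a i)
      (fun i => f p * b' i + g p * b i) p := by
  obtain ⟨L, hL, hv⟩ := hf
  obtain ⟨L', hL', hv'⟩ := hg
  refine ⟨_, hL.mul hL', fun v => ?_⟩
  simp only [add_apply, smul_apply, hv, hv', smul_eq_mul,
    Finset.mul_sum, ← Finset.sum_add_distrib]
  exact Finset.sum_congr rfl fun i _ => by ring

lemma HasWirtingerAt.const_mul (hf : HasWirtingerAt f a b p) (c : ℂ) :
    HasWirtingerAt (fun q => c * f q) (fun i => c * a i) (fun i => c * b i) p := by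
  simpa using (hasWirtingerAt_const c).mul hf

lemma HasWirtingerAt.neg (hf : HasWirtingerAt f a b p) :
    HasWirtingerAt (fun q => -f q) (fun i => -a i) (fun i => -b i) p := by
  simpa using hf.const_mul (-1)

lemma HasWirtingerAt.sub (hf : HasWirtingerAt f a b p) (hg : HasWirtingerAt g a' b' p) :
    HasWirtingerAt (fun q => f q - g q) (fun i => a i - a' i) (fun i => b i - b' i) p := by
  simpa [sub_eq_add_neg] using hf.add hg.neg

lemma HasWirtingerAt.sum {ι : Type*} (s : Finset ι) {f : ι → (Fin n → ℂ) → ℂ}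
    {a b : ι → Fin n → ℂ} (h : ∀ j ∈ s, HasWirtingerAt (f j) (a j) (b j) p) :
    HasWirtingerAt (fun q => ∑ j ∈ s, f j q) (fun i => ∑ j ∈ s, a j i)
      (fun i => ∑ j ∈ s, b j i) p := by
  classical
  induction s using Finset.induction_on with
  | empty => exact hasWirtingerAt_const 0
  | insert j s hj ih =>
    simp only [Finset.sum_insert hj]
    exact (h j (Finset.mem_insert_self j s)).add
      (ih fun k hk => h k (Finset.mem_insert_of_mem hk))

lemma HasWirtingerAt.inv (hf : HasWirtingerAt f a b p) (h0 : f p ≠ 0) :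
    HasWirtingerAt (fun q => (f q)⁻¹) (fun i => -a i / f p ^ 2) (fun i => -b i / f p ^ 2) p := by
  obtain ⟨L, hL, hv⟩ := hf
  have h1 : HasFDerivAt (fun x : ℂ => x⁻¹)
      ((ContinuousLinearMap.toSpanSingleton ℂ (-(f p ^ 2)⁻¹)).restrictScalars ℝ) (f p) :=
    (hasDerivAt_inv h0).hasFDerivAt.restrictScalars ℝ
  refine ⟨_, h1.comp p hL, fun v => ?_⟩
  rw [ContinuousLinearMap.comp_apply, hv]
  change (∑ i, (a i * v i + b i * (starRingEnd ℂ) (v i))) • (-(f p ^ 2)⁻¹) = _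
  rw [smul_eq_mul, Finset.sum_mul]
  exact Finset.sum_congr rfl fun i _ => by ring

lemma HasWirtingerAt.conj (hf : HasWirtingerAt f a b p) :
    HasWirtingerAt (fun q => conj (f q)) (fun i => conj (b i)) (fun i => conj (a i)) p := by
  obtain ⟨L, hL, hv⟩ := hf
  refine ⟨_, Complex.conjCLE.toContinuousLinearMap.hasFDerivAt.comp p hL, fun v => ?_⟩
  rw [ContinuousLinearMap.comp_apply, hv]
  change (starRingEnd ℂ) (∑ i, _) = _
  rw [map_sum]
  exact Finset.sum_congr rfl fun i _ => by simp [add_comm]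

/-- Wirtinger derivatives of a function of a real-valued function. -/
lemma HasWirtingerAt.comp_ofReal {F : (Fin n → ℂ) → ℝ} {φ : ℝ → ℝ} {φ' : ℝ}
    (hf : HasWirtingerAt (fun q => (F q : ℂ)) a b p) (hφ : HasDerivAt φ φ' (F p)) :
    HasWirtingerAt (fun q => (φ (F q) : ℂ)) (fun i => φ' * a i) (fun i => φ' * b i) p := by
  obtain ⟨L, hL, hv⟩ := hf
  have hF : HasFDerivAt F (Complex.reCLM ∘L L) p := Complex.reCLM.hasFDerivAt.comp p hL
  have hL' : L = Complex.ofRealCLM ∘L Complex.reCLM ∘L L :=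
    hL.unique (Complex.ofRealCLM.hasFDerivAt.comp p hF)
  refine ⟨_, Complex.ofRealCLM.hasFDerivAt.comp p (hφ.comp_hasFDerivAt p hF), fun v => ?_⟩
  have h1 : L v = ((L v).re : ℂ) := congrArg (fun M => M v) hL'
  have h2 : ∑ i, (φ' * a i * v i + φ' * b i * (starRingEnd ℂ) (v i)) = φ' * L v := by
    rw [hv, Finset.mul_sum]
    exact Finset.sum_congr rfl fun i _ => by ring
  rw [h2, h1]
  simp

lemma _root_.DifferentiableAt.hasWirtingerAt_holomorphic (hf : DifferentiableAt ℂ f p) :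
    HasWirtingerAt f (fun i => fderiv ℂ f p (Pi.single i 1)) 0 p := by
  refine ⟨_, hf.hasFDerivAt.restrictScalars ℝ, fun v => ?_⟩
  change fderiv ℂ f p v = _
  conv_lhs => rw [← Finset.univ_sum_single v]
  rw [map_sum]
  refine Finset.sum_congr rfl fun i _ => ?_
  have : Pi.single i (v i) = v i • (Pi.single i 1 : Fin n → ℂ) := by
    rw [← Pi.single_smul]; simp
  rw [this, map_smul]
  simp [mul_comm]

lemma HasWirtingerAt.comp_holomorphic {m : ℕ} {s : (Fin m → ℂ) → (Fin n → ℂ)} {q : Fin m → ℂ}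
    (hf : HasWirtingerAt f a b (s q)) (hs : DifferentiableAt ℂ s q) :
    HasWirtingerAt (fun x => f (s x))
      (fun k => ∑ l, a l * fderiv ℂ s q (Pi.single k 1) l)
      (fun k => ∑ l, b l * (starRingEnd ℂ) (fderiv ℂ s q (Pi.single k 1) l)) q := by
  obtain ⟨L, hL, hv⟩ := hf
  refine ⟨_, hL.comp q (hs.hasFDerivAt.restrictScalars ℝ), fun v => ?_⟩
  have h1 : ∀ l, fderiv ℂ s q v l = ∑ k, v k * fderiv ℂ s q (Pi.single k 1) l := by
    intro l
    conv_lhs => rw [← Finset.univ_sum_single v]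
    rw [map_sum, Finset.sum_apply]
    refine Finset.sum_congr rfl fun i _ => ?_
    have : Pi.single i (v i) = v i • (Pi.single i 1 : Fin m → ℂ) := by
      rw [← Pi.single_smul]; simp
    rw [this, map_smul]
    simp
  rw [ContinuousLinearMap.comp_apply, hv]
  change ∑ l, (a l * fderiv ℂ s q v l + b l * (starRingEnd ℂ) (fderiv ℂ s q v l)) = _
  simp only [h1, map_sum, map_mul, Finset.mul_sum, Finset.sum_mul, ← Finset.sum_add_distrib]
  rw [Finset.sum_comm]
  exact Finset.sum_congr rfl fun i _ => Finset.sum_congr rfl fun j _ => by ring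

/-- Wirtinger derivatives of the inner product of two holomorphic maps. -/
lemma hasWirtingerAt_inner {H : Type*} [NormedAddCommGroup H] [InnerProductSpace ℂ H]
    {k l : (Fin n → ℂ) → H} (hk : DifferentiableAt ℂ k p) (hl : DifferentiableAt ℂ l p) :
    HasWirtingerAt (fun q => inner ℂ (k q) (l q))
      (fun i => inner ℂ (k p) (fderiv ℂ l p (Pi.single i 1)))
      (fun i => inner ℂ (fderiv ℂ k p (Pi.single i 1)) (l p)) p := by
  let : InnerProductSpace ℝ H := InnerProductSpace.rclikeToReal ℂ H
  refine ⟨_, (hk.hasFDerivAt.restrictScalars ℝ).inner ℂ (hl.hasFDerivAt.restrictScalars ℝ),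
    fun v => ?_⟩
  change inner ℂ (k p) (fderiv ℂ l p v) + inner ℂ (fderiv ℂ k p v) (l p) = _
  have h1 : ∀ φ : (Fin n → ℂ) →L[ℂ] H, φ v = ∑ i, v i • φ (Pi.single i 1) := by
    intro φ
    conv_lhs => rw [← Finset.univ_sum_single v]
    rw [map_sum]
    refine Finset.sum_congr rfl fun i _ => ?_
    have : Pi.single i (v i) = v i • (Pi.single i 1 : Fin n → ℂ) := by
      rw [← Pi.single_smul]; simp
    rw [this, map_smul]
  rw [h1 (fderiv ℂ l p), h1 (fderiv ℂ k p), inner_sum, sum_inner, ← Finset.sum_add_distrib]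
  refine Finset.sum_congr rfl fun i _ => ?_
  rw [inner_smul_left, inner_smul_right]
  ring

lemma dz_congr (h : f =ᶠ[𝓝 p] g) (i : Fin n) : dz i f p = dz i g p := by
  simp only [dz, h.fderiv_eq]

lemma dzbar_congr (h : f =ᶠ[𝓝 p] g) (i : Fin n) : dzbar i f p = dzbar i g p := by
  simp only [dzbar, h.fderiv_eq]

lemma contDiffOn_dz {U : Set (Fin n → ℂ)} (hU : IsOpen U) {m : ℕ}
    (hf : ContDiffOn ℝ (m + 1 : ℕ) f U) (i : Fin n) : ContDiffOn ℝ m (dz i f) U := by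
  have h1 : ContDiffOn ℝ m (fderiv ℝ f) U := hf.fderiv_of_isOpen hU (by push_cast; rfl)
  exact contDiffOn_const.mul ((h1.clm_apply contDiffOn_const).sub
    (contDiffOn_const.mul (h1.clm_apply contDiffOn_const)))

lemma contDiffOn_dzbar {U : Set (Fin n → ℂ)} (hU : IsOpen U) {m : ℕ}
    (hf : ContDiffOn ℝ (m + 1 : ℕ) f U) (i : Fin n) : ContDiffOn ℝ m (dzbar i f) U := by
  have h1 : ContDiffOn ℝ m (fderiv ℝ f) U := hf.fderiv_of_isOpen hU (by push_cast; rfl)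
  exact contDiffOn_const.mul ((h1.clm_apply contDiffOn_const).add
    (contDiffOn_const.mul (h1.clm_apply contDiffOn_const)))

end Wirtinger

/-! ### Symmetries -/

/-- The differential of an involution at an isolated fixed point `p` is `-1`: near `p` the
involution is conjugate to its differential `L` by `z ↦ (z + L (s z)) / 2`, so that a fixed vector
of `L` would give a curve of fixed points. -/
lemma fderiv_symmetry_eq_neg {d : ℕ} {Ω : Set (Fin d → ℂ)} (hΩ : IsOpen Ω)
    {s : (Fin d → ℂ) → (Fin d → ℂ)} {p : Fin d → ℂ} (hp : p ∈ Ω) (hs : DifferentiableOn ℂ s Ω)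
    (hinv : ∀ z ∈ Ω, s (s z) = z) (hsp : s p = p) (hiso : ∀ᶠ z in 𝓝[≠] p, s z ≠ z)
    (v : Fin d → ℂ) : fderiv ℂ s p v = -v := by
  set L := fderiv ℂ s p with hL_def
  have hsd : DifferentiableAt ℂ s p := hs.differentiableAt (hΩ.mem_nhds hp)
  have hL : HasFDerivAt s L p := hsd.hasFDerivAt
  have hLL : ∀ v, L (L v) = v := by
    have h1 : HasFDerivAt (s ∘ s) (L ∘L L) p := HasFDerivAt.comp p (by rwa [hsp]) hL
    have h2 : HasFDerivAt (s ∘ s) (ContinuousLinearMap.id ℂ _) p :=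
      (hasFDerivAt_id p).congr_of_eventuallyEq
        (by filter_upwards [hΩ.mem_nhds hp] with z hz using hinv z hz)
    intro v
    exact congrArg (fun M => M v) (h1.unique h2)
  have hfix : ∀ v, L v = v → v = 0 := by
    intro v hv
    by_contra hv0
    let G : (Fin d → ℂ) → (Fin d → ℂ) := fun z => (2⁻¹ : ℂ) • (z + L (s z))
    have hG : HasStrictFDerivAt G
        ((ContinuousLinearEquiv.refl ℂ (Fin d → ℂ) : _ →L[ℂ] (Fin d → ℂ))) p := by
      have hGc : ContDiffAt ℂ 1 G p := by
        have := (contDiffOn_of_differentiableOn hΩ hs 1).contDiffAt (hΩ.mem_nhds hp)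
        exact (contDiffAt_id.add (L.contDiff.contDiffAt.comp p this)).const_smul (2⁻¹ : ℂ)
      refine hGc.hasStrictFDerivAt' ?_ (by simp)
      have h1 : HasFDerivAt G ((2⁻¹ : ℂ) • (ContinuousLinearMap.id ℂ _ + L ∘L L)) p :=
        ((hasFDerivAt_id p).add (L.hasFDerivAt.comp p hL)).fun_const_smul (2⁻¹ : ℂ)
      have h2 : ((ContinuousLinearEquiv.refl ℂ (Fin d → ℂ) : _ →L[ℂ] (Fin d → ℂ)))
          = (2⁻¹ : ℂ) • (ContinuousLinearMap.id ℂ _ + L ∘L L) := by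
        refine ContinuousLinearMap.ext fun w => ?_
        change w = (2⁻¹ : ℂ) • (w + L (L w))
        rw [hLL, ← two_smul ℂ w, smul_smul]
        norm_num
      rw [h2]
      exact h1
    have hsc : ContinuousAt s p := hsd.continuousAt
    -- The curve of fixed points: the preimage under `G` of the line `G p + ℂ v`.
    let c : ℂ → (Fin d → ℂ) := fun t => hG.localInverse G _ p (G p + t • v)
    have hline : Tendsto (fun t : ℂ => G p + t • v) (𝓝 0) (𝓝 (G p)) := by
      have : Continuous fun t : ℂ => G p + t • v := by fun_prop
      simpa using this.tendsto 0
    have hc : Tendsto c (𝓝 0) (𝓝 p) := by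
      have := hG.localInverse_continuousAt.tendsto
      rw [hG.localInverse_apply_image] at this
      exact this.comp hline
    have hGc : ∀ᶠ t in 𝓝 (0 : ℂ), G (c t) = G p + t • v :=
      hline.eventually hG.eventually_right_inverse
    have hleft := hG.eventually_left_inverse
    have hsc' : Tendsto (fun t => s (c t)) (𝓝 0) (𝓝 p) := by
      have := hsc.tendsto
      rw [hsp] at this
      exact this.comp hc
    have hfixed : ∀ᶠ t in 𝓝 (0 : ℂ), s (c t) = c t := by
      filter_upwards [hGc, hc.eventually (hΩ.mem_nhds hp), hc.eventually hleft,
        hsc'.eventually hleft] with t h1 h2 h3 h4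
      have h5 : G (s (c t)) = L (G (c t)) := by
        simp only [G]
        rw [hinv _ h2, map_smul, map_add, hLL, add_comm]
      have h6 : L (G p) = G p := by
        simp only [G]
        rw [hsp, map_smul, map_add, hLL, add_comm]
      have h7 : L (G (c t)) = G (c t) := by rw [h1, map_add, h6, L.map_smul, hv]
      rw [← h4, h5, h7, h3]
    have hne : Tendsto c (𝓝[≠] 0) (𝓝[≠] p) := by
      refine tendsto_nhdsWithin_iff.2 ⟨hc.mono_left nhdsWithin_le_nhds, ?_⟩
      filter_upwards [hGc.filter_mono nhdsWithin_le_nhds, self_mem_nhdsWithin] with t h1 h2 h3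
      rw [Set.mem_singleton_iff.1 h3] at h1
      have : t • v = 0 := by simpa using h1.symm
      exact (smul_ne_zero h2 hv0) this
    obtain ⟨t, h1, h2⟩ :=
      ((hne.eventually hiso).and (hfixed.filter_mono nhdsWithin_le_nhds)).exists
    exact h1 h2
  -- `v + L v` is fixed by `L` since `L² = 1`.
  have := hfix (v + L v) (by rw [map_add, hLL, add_comm])
  exact (neg_eq_of_add_eq_zero_right this).symm

/-! ### Transformation rules under a symmetry -/

/-- The complex Jacobian matrix of a map `s`. -/
noncomputable def jacobian {d : ℕ} (s : (Fin d → ℂ) → (Fin d → ℂ)) (z : Fin d → ℂ) :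
    Matrix (Fin d) (Fin d) ℂ :=
  LinearMap.toMatrix' (fderiv ℂ s z : (Fin d → ℂ) →ₗ[ℂ] (Fin d → ℂ))

section Transformation

variable {d : ℕ} {Ω : Set (Fin d → ℂ)} {s : (Fin d → ℂ) → (Fin d → ℂ)}

lemma jacobian_apply (z : Fin d → ℂ) (l k : Fin d) :
    jacobian s z l k = fderiv ℂ s z (Pi.single k 1) l := by
  rw [jacobian, LinearMap.toMatrix'_apply]
  rfl

/-- The real determinant of a complex-linear map is `|det|²`. -/
lemma det_restrictScalars_eq (A : (Fin d → ℂ) →L[ℂ] (Fin d → ℂ)) :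
    (A.restrictScalars ℝ).det
      = Complex.normSq (LinearMap.toMatrix' (A : (Fin d → ℂ) →ₗ[ℂ] (Fin d → ℂ))).det := by
  rw [LinearMap.det_toMatrix', ← Algebra.norm_complex_apply, ← LinearMap.det_restrictScalars]
  rfl

lemma differentiableOn_jacobian (hΩ : IsOpen Ω) (hs : DifferentiableOn ℂ s Ω) (l k : Fin d) :
    DifferentiableOn ℂ (fun z => jacobian s z l k) Ω := by
  simp_rw [jacobian_apply]
  exact differentiableOn_pi.1 (differentiableOn_fderiv_apply hΩ hs (Pi.single k 1)) l

lemma contDiffOn_det {𝕜 E : Type*} [NontriviallyNormedField 𝕜] [NormedAlgebra 𝕜 ℂ]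
    [NormedAddCommGroup E] [NormedSpace 𝕜 E] {U : Set E} {m : ℕ} {n : ℕ}
    {A : E → Matrix (Fin m) (Fin m) ℂ} (h : ∀ l k, ContDiffOn 𝕜 n (fun z => A z l k) U) :
    ContDiffOn 𝕜 n (fun z => (A z).det) U := by
  simp_rw [Matrix.det_apply]
  exact ContDiffOn.sum fun σ _ => (contDiffOn_prod fun i _ => h (σ i) i).const_smul _

lemma differentiableOn_det {A : (Fin d → ℂ) → Matrix (Fin d) (Fin d) ℂ} (hΩ : IsOpen Ω)
    (h : ∀ l k, DifferentiableOn ℂ (fun z => A z l k) Ω) :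
    DifferentiableOn ℂ (fun z => (A z).det) Ω :=
  (contDiffOn_det fun l k => contDiffOn_of_differentiableOn hΩ (h l k) 1).differentiableOn
    one_ne_zero

/-- A holomorphic involution of an open set `Ω`. -/
structure IsHolInvolution (Ω : Set (Fin d → ℂ)) (s : (Fin d → ℂ) → (Fin d → ℂ)) : Prop where
  differentiableOn : DifferentiableOn ℂ s Ω
  mapsTo : Set.MapsTo s Ω Ω
  invol : ∀ z ∈ Ω, s (s z) = z

lemma IsHolInvolution.jacobian_mul (hΩ : IsOpen Ω) (h : IsHolInvolution Ω s) {z : Fin d → ℂ}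
    (hz : z ∈ Ω) : jacobian s (s z) * jacobian s z = 1 := by
  have h1 := (h.differentiableOn.differentiableAt (hΩ.mem_nhds hz)).hasFDerivAt
  have h2 := (h.differentiableOn.differentiableAt (hΩ.mem_nhds (h.mapsTo hz))).hasFDerivAt
  have h3 := h2.comp z h1
  have h4 : HasFDerivAt (s ∘ s) (ContinuousLinearMap.id ℂ _) z :=
    (hasFDerivAt_id z).congr_of_eventuallyEq
      (by filter_upwards [hΩ.mem_nhds hz] with z hz using h.invol z hz)
  have h5 := h3.unique h4
  rw [jacobian, jacobian, ← LinearMap.toMatrix'_comp, ← ContinuousLinearMap.toLinearMap_comp, h5]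
  exact LinearMap.toMatrix'_id

lemma IsHolInvolution.det_mul (hΩ : IsOpen Ω) (h : IsHolInvolution Ω s) {z : Fin d → ℂ}
    (hz : z ∈ Ω) : (jacobian s (s z)).det * (jacobian s z).det = 1 := by
  rw [← Matrix.det_mul, h.jacobian_mul hΩ hz, Matrix.det_one]

lemma IsHolInvolution.det_ne_zero (hΩ : IsOpen Ω) (h : IsHolInvolution Ω s) {z : Fin d → ℂ}
    (hz : z ∈ Ω) : (jacobian s z).det ≠ 0 :=
  right_ne_zero_of_mul_eq_one (h.det_mul hΩ hz)

lemma IsHolInvolution.image_eq (h : IsHolInvolution Ω s) : s '' Ω = Ω :=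
  Set.Subset.antisymm h.mapsTo.image_subset fun z hz => ⟨s z, h.mapsTo hz, h.invol z hz⟩

lemma IsHolInvolution.injOn (h : IsHolInvolution Ω s) : Set.InjOn s Ω := fun x hx y hy hxy => by
  rw [← h.invol x hx, hxy, h.invol y hy]

lemma IsHolInvolution.hasFDerivWithinAt (hΩ : IsOpen Ω) (h : IsHolInvolution Ω s) :
    ∀ z ∈ Ω, HasFDerivWithinAt s ((fderiv ℂ s z).restrictScalars ℝ) Ω z := fun _ hz =>
  ((h.differentiableOn.differentiableAt
    (hΩ.mem_nhds hz)).hasFDerivAt.restrictScalars ℝ).hasFDerivWithinAt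

lemma IsHolInvolution.abs_det (z : Fin d → ℂ) :
    |((fderiv ℂ s z).restrictScalars ℝ).det| = Complex.normSq (jacobian s z).det := by
  rw [det_restrictScalars_eq, abs_of_nonneg (Complex.normSq_nonneg _)]; rfl

/-- The pull-back `(f ∘ s) · det s'` of a square integrable holomorphic function. -/
lemma IsHolInvolution.memBergman_pullback (hΩ : IsOpen Ω) (h : IsHolInvolution Ω s)
    {f : (Fin d → ℂ) → ℂ} (hf : MemBergman Ω f) :
    MemBergman Ω fun z => f (s z) * (jacobian s z).det := by
  have hd : DifferentiableOn ℂ (fun z => f (s z) * (jacobian s z).det) Ω :=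
    (hf.1.comp h.differentiableOn h.mapsTo).mul
      (differentiableOn_det hΩ fun l k => differentiableOn_jacobian hΩ h.differentiableOn l k)
  refine ⟨hd, ?_⟩
  rw [memLp_two_iff_integrable_sq_norm (hd.continuousOn.aestronglyMeasurable hΩ.measurableSet)]
  have h1 := (memLp_two_iff_integrable_sq_norm hf.2.1).1 hf.2
  have h2 := (integrableOn_image_iff_integrableOn_abs_det_fderiv_smul volume hΩ.measurableSet
    (h.hasFDerivWithinAt hΩ) h.injOn (fun z => ‖f z‖ ^ 2)).1 (by rw [h.image_eq]; exact h1)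
  refine h2.congr_fun (fun z _ => ?_) hΩ.measurableSet
  simp only [abs_det, smul_eq_mul, norm_mul, mul_pow, Complex.normSq_eq_norm_sq]
  ring

/-- If `k` reproduces the value at `s w`, then `conj (det s'(w)) (k ∘ s) det s'` reproduces the
value at `w`. -/
lemma IsHolInvolution.reproduces (hΩ : IsOpen Ω) (h : IsHolInvolution Ω s) {w : Fin d → ℂ}
    (hw : w ∈ Ω) {k : (Fin d → ℂ) → ℂ} (hk : Reproduces Ω (s w) k) :
    Reproduces Ω w fun z => conj (jacobian s w).det * (k (s z) * (jacobian s z).det) := by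
  have hpb := h.memBergman_pullback hΩ hk.1
  refine ⟨⟨hpb.1.const_mul _, hpb.2.const_mul _⟩, fun f hf => ?_⟩
  have h1 := hk.2 _ (h.memBergman_pullback hΩ hf)
  rw [h.invol w hw] at h1
  have h2 := integral_image_eq_integral_abs_det_fderiv_smul volume hΩ.measurableSet
    (h.hasFDerivWithinAt hΩ) h.injOn (fun z => f (s z) * (jacobian s z).det * conj (k z))
  rw [h.image_eq, h1] at h2
  have h3 : ∫ z in Ω, f z * conj (conj (jacobian s w).det * (k (s z) * (jacobian s z).det))
      = (jacobian s w).det * (f w * (jacobian s (s w)).det) := by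
    rw [h2, ← integral_const_mul]
    refine setIntegral_congr_fun hΩ.measurableSet fun z hz => ?_
    have h4 := h.det_mul hΩ hz
    simp only [abs_det, Complex.real_smul, h.invol z hz, map_mul, Complex.conj_conj,
      ← Complex.mul_conj]
    linear_combination (-(f z * (jacobian s w).det * conj (k (s z)) *
      conj (jacobian s z).det)) * h4
  rw [h3]
  linear_combination f w * h.det_mul hΩ hw

lemma IsHolInvolution.bergmanKernel_eq (hΩ : IsOpen Ω) (h : IsHolInvolution Ω s) {z : Fin d → ℂ}
    (hz : z ∈ Ω) : bergmanKernel Ω z z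
      = bergmanKernel Ω (s z) (s z) * Complex.normSq (jacobian s z).det := by
  have hsz := h.mapsTo hz
  rw [(h.reproduces hΩ hz (reproduces_bergmanKernel hΩ hsz)).bergmanKernel_eq hΩ hz,
    ← Complex.mul_conj]
  ring

end Transformation

/-! ### The Bergman metric -/

section

open scoped ComplexOrder

variable {d : ℕ} {Ω : Set (Fin d → ℂ)}

/-- The function `log K(z, z)`, the Kähler potential of the Bergman metric. -/
noncomputable def logKernel (Ω : Set (Fin d → ℂ)) (z : Fin d → ℂ) : ℝ :=
  Real.log (bergmanKernel Ω z z).re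

/-- On a bounded domain the map `k` of `exists_bergman_map` does not vanish, and none of its
derivatives is a multiple of it: pair `k` with the vectors that represent the constant `1` and the
coordinate functions. -/
lemma exists_nondegenerate_bergman_map (hΩ : IsOpen Ω) (hb : Bornology.IsBounded Ω) :
    ∃ (H : Type) (_ : NormedAddCommGroup H) (_ : InnerProductSpace ℂ H) (_ : CompleteSpace H)
      (k : (Fin d → ℂ) → H), DifferentiableOn ℂ k Ω ∧
      (∀ z ∈ Ω, bergmanKernel Ω z z = ((‖k z‖ ^ 2 : ℝ) : ℂ)) ∧ (∀ z ∈ Ω, k z ≠ 0) ∧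
      ∀ z ∈ Ω, ∀ v, v ≠ 0 → ∀ c : ℂ, fderiv ℂ k z v ≠ c • k z := by
  obtain ⟨H, i₁, i₂, i₃, k, hk, hK, hf⟩ := exists_bergman_map hΩ
  obtain ⟨a, ha⟩ := hf (fun _ => 1) (memBergman_of_differentiable hΩ hb (differentiable_const 1))
  refine ⟨H, i₁, i₂, i₃, k, hk, fun z hz => ?_, fun z hz h0 => ?_, fun z hz v hv c h => ?_⟩
  · rw [hK z hz z hz, inner_self_eq_norm_sq_to_K]; push_cast; rfl
  · have := ha z hz
    rw [h0, inner_zero_right] at this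
    exact zero_ne_one this
  · have hkz : DifferentiableAt ℂ k z := hk.differentiableAt (hΩ.mem_nhds hz)
    have key : ∀ (b : H) (f : (Fin d → ℂ) → ℂ) (f' : (Fin d → ℂ) →L[ℂ] ℂ),
        (∀ z ∈ Ω, inner ℂ b (k z) = f z) → HasFDerivAt f f' z →
        inner ℂ b (fderiv ℂ k z v) = f' v := by
      intro b f f' hbf hf'
      have h1 : HasFDerivAt (fun q => inner ℂ b (k q)) (innerSL ℂ b ∘L fderiv ℂ k z) z :=
        (innerSL ℂ b).hasFDerivAt.comp z hkz.hasFDerivAt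
      have h2 : HasFDerivAt (fun q => inner ℂ b (k q)) f' z :=
        hf'.congr_of_eventuallyEq (by filter_upwards [hΩ.mem_nhds hz] with q hq using hbf q hq)
      exact congrArg (fun M => M v) (h1.unique h2)
    have hc : c = 0 := by
      have := key a _ 0 ha (hasFDerivAt_const 1 z)
      rw [h, inner_smul_right, ha z hz] at this
      simpa using this
    refine hv (funext fun i => ?_)
    obtain ⟨b, hb'⟩ := hf (fun z => z i) (memBergman_of_differentiable hΩ hb (by fun_prop))
    have := key b _ (ContinuousLinearMap.proj i) hb' (hasFDerivAt_apply i z)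
    rw [h, hc, zero_smul, inner_zero_right] at this
    exact this.symm

lemma bergmanKernel_self_re_pos (hΩ : IsOpen Ω) (hb : Bornology.IsBounded Ω) {z : Fin d → ℂ}
    (hz : z ∈ Ω) : 0 < (bergmanKernel Ω z z).re := by
  obtain ⟨H, _, _, _, k, -, hK, hk0, -⟩ := exists_nondegenerate_bergman_map hΩ hb
  rw [hK z hz, Complex.ofReal_re]
  exact pow_pos (norm_pos_iff.2 (hk0 z hz)) 2

lemma contDiffOn_bergmanKernel_self (hΩ : IsOpen Ω) (hb : Bornology.IsBounded Ω) (n : ℕ) :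
    ContDiffOn ℝ n (fun z => (bergmanKernel Ω z z).re) Ω := by
  obtain ⟨H, _, _, _, k, hk, hK, -, -⟩ := exists_nondegenerate_bergman_map hΩ hb
  have h1 : ContDiffOn ℝ n k Ω := (contDiffOn_of_differentiableOn hΩ hk n).restrict_scalars ℝ
  let : InnerProductSpace ℝ H := InnerProductSpace.rclikeToReal ℂ H
  refine (h1.norm_sq ℝ).congr fun z hz => ?_
  rw [hK z hz, Complex.ofReal_re]

lemma contDiffOn_logKernel (hΩ : IsOpen Ω) (hb : Bornology.IsBounded Ω) (n : ℕ) :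
    ContDiffOn ℝ n (logKernel Ω) Ω :=
  (contDiffOn_bergmanKernel_self hΩ hb n).log fun _ hz =>
    (bergmanKernel_self_re_pos hΩ hb hz).ne'

lemma contDiffOn_ofReal_logKernel (hΩ : IsOpen Ω) (hb : Bornology.IsBounded Ω) (n : ℕ) :
    ContDiffOn ℝ n (fun z => (logKernel Ω z : ℂ)) Ω :=
  Complex.ofRealCLM.contDiff.comp_contDiffOn (contDiffOn_logKernel hΩ hb n)

lemma contDiffOn_bergmanMetric (hΩ : IsOpen Ω) (hb : Bornology.IsBounded Ω) (n : ℕ)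
    (α β : Fin d) : ContDiffOn ℝ n (fun z => bergmanMetric Ω z α β) Ω :=
  contDiffOn_dz hΩ (contDiffOn_dzbar hΩ (contDiffOn_ofReal_logKernel hΩ hb _) β) α

/-- The Hermitian form `∂∂̄ log ‖k‖²` is positive definite when no derivative of `k` is a multiple
of `k`: this is the strict Cauchy–Schwarz inequality. -/
lemma posDef_of_inner {H : Type*} [NormedAddCommGroup H] [InnerProductSpace ℂ H] {x : H}
    {D : Fin d → H} (hx : x ≠ 0) (hD : ∀ v : Fin d → ℂ, v ≠ 0 → ∀ c : ℂ, ∑ i, v i • D i ≠ c • x)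
    {B : Matrix (Fin d) (Fin d) ℂ}
    (hB : ∀ α β, B α β = (((‖x‖ ^ 2 : ℝ) : ℂ) * inner ℂ (D β) (D α)
      - inner ℂ (D β) x * inner ℂ x (D α)) / ((‖x‖ ^ 2 : ℝ) : ℂ) ^ 2) : B.PosDef := by
  refine Matrix.PosDef.of_dotProduct_mulVec_pos ?_ fun v hv => ?_
  · ext α β
    rw [Matrix.conjTranspose_apply, hB, hB]
    simp only [RCLike.star_def, map_div₀, map_sub, map_mul, map_pow, Complex.conj_ofReal,
      inner_conj_symm]
    ring
  · set y := ∑ i, conj (v i) • D i with hy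
    have hv' : (fun i => conj (v i)) ≠ 0 := fun h => hv (funext fun i => by
      simpa using congrFun h i)
    have hyx : ∀ c : ℂ, y ≠ c • x := hD _ hv'
    have hy0 : y ≠ 0 := by simpa using hyx 0
    have hlt : ‖inner ℂ x y‖ < ‖x‖ * ‖y‖ := by
      refine lt_of_le_of_ne (norm_inner_le_norm x y) fun h => ?_
      obtain ⟨r, -, hr⟩ := (norm_inner_eq_norm_iff hx hy0).1 h
      exact hyx r hr
    have h1 : inner ℂ y y = ∑ α, ∑ β, conj (v α) * (inner ℂ (D β) (D α)) * v β := by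
      simp only [hy, sum_inner, inner_sum, inner_smul_left, inner_smul_right, Complex.conj_conj,
        Finset.mul_sum]
      exact Finset.sum_congr rfl fun i _ => Finset.sum_congr rfl fun j _ => by ring
    have h2 : inner ℂ y x * inner ℂ x y
        = ∑ α, ∑ β, conj (v α) * (inner ℂ (D β) x * inner ℂ x (D α)) * v β := by
      simp only [hy, sum_inner, inner_sum, inner_smul_left, inner_smul_right, Complex.conj_conj]
      rw [mul_comm, Finset.sum_mul_sum]
      exact Finset.sum_congr rfl fun i _ => Finset.sum_congr rfl fun j _ => by ring
    have h3 : star v ⬝ᵥ B.mulVec v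
        = (((‖x‖ ^ 2 : ℝ) : ℂ) * inner ℂ y y - inner ℂ y x * inner ℂ x y)
          / ((‖x‖ ^ 2 : ℝ) : ℂ) ^ 2 := by
      rw [h1, h2]
      simp only [dotProduct, Matrix.mulVec, Finset.mul_sum, hB, Pi.star_apply, RCLike.star_def]
      rw [← Finset.sum_sub_distrib, Finset.sum_div]
      refine Finset.sum_congr rfl fun i _ => ?_
      rw [← Finset.sum_sub_distrib, Finset.sum_div]
      exact Finset.sum_congr rfl fun j _ => by ring
    have h4 : star v ⬝ᵥ B.mulVec v
        = (((‖x‖ ^ 2 * ‖y‖ ^ 2 - ‖inner ℂ x y‖ ^ 2) / (‖x‖ ^ 2) ^ 2 : ℝ) : ℂ) := by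
      have h5 : inner ℂ y x * inner ℂ x y = ((‖inner ℂ x y‖ ^ 2 : ℝ) : ℂ) := by
        rw [← inner_conj_symm, Complex.conj_mul']; push_cast; rfl
      have h6 : inner ℂ y y = ((‖y‖ ^ 2 : ℝ) : ℂ) := by
        rw [inner_self_eq_norm_sq_to_K]; push_cast; rfl
      rw [h3, h5, h6]
      push_cast
      rfl
    rw [h4, Complex.zero_lt_real]
    have hx0 : 0 < ‖x‖ := norm_pos_iff.2 hx
    refine div_pos ?_ (by positivity)
    nlinarith [norm_nonneg (inner ℂ x y), norm_nonneg y]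

lemma posDef_bergmanMetric (hΩ : IsOpen Ω) (hb : Bornology.IsBounded Ω) {z : Fin d → ℂ}
    (hz : z ∈ Ω) : (bergmanMetric Ω z).PosDef := by
  obtain ⟨H, _, _, _, k, hk, hK, hk0, hnd⟩ := exists_nondegenerate_bergman_map hΩ hb
  have hkd : ∀ q ∈ Ω, DifferentiableAt ℂ k q := fun q hq => hk.differentiableAt (hΩ.mem_nhds hq)
  have hself : ∀ q ∈ Ω, HasWirtingerAt (fun q => ((‖k q‖ ^ 2 : ℝ) : ℂ))
      (fun i => inner ℂ (k q) (fderiv ℂ k q (Pi.single i 1)))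
      (fun i => inner ℂ (fderiv ℂ k q (Pi.single i 1)) (k q)) q := fun q hq =>
    (hasWirtingerAt_inner (hkd q hq) (hkd q hq)).congr (Eventually.of_forall fun x => by
      simp only
      rw [inner_self_eq_norm_sq_to_K]; push_cast; rfl)
  have hlog : ∀ q ∈ Ω, ∀ β, dzbar β (fun x => (logKernel Ω x : ℂ)) q
      = (((‖k q‖ ^ 2 : ℝ) : ℂ))⁻¹ * inner ℂ (fderiv ℂ k q (Pi.single β 1)) (k q) := by
    intro q hq β
    have hpos : ‖k q‖ ^ 2 ≠ 0 := pow_ne_zero 2 (norm_ne_zero_iff.2 (hk0 q hq))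
    have h1 := (hself q hq).comp_ofReal (Real.hasDerivAt_log hpos)
    have h2 := h1.congr (g := fun x => (logKernel Ω x : ℂ)) (by
      filter_upwards [hΩ.mem_nhds hq] with x hx
      rw [logKernel, hK x hx, Complex.ofReal_re])
    rw [h2.dzbar β]
    push_cast
    rfl
  refine posDef_of_inner (x := k z) (D := fun i => fderiv ℂ k z (Pi.single i 1)) (hk0 z hz)
    (fun v hv c => ?_) fun α β => ?_
  · have : ∑ i, v i • fderiv ℂ k z (Pi.single i 1) = fderiv ℂ k z v := by
      conv_rhs => rw [← Finset.univ_sum_single v]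
      rw [map_sum]
      refine Finset.sum_congr rfl fun i _ => ?_
      rw [← map_smul, ← Pi.single_smul]
      simp
    rw [this]
    exact hnd z hz v hv c
  · have hpos : ((‖k z‖ ^ 2 : ℝ) : ℂ) ≠ 0 :=
      Complex.ofReal_ne_zero.2 (pow_ne_zero 2 (norm_ne_zero_iff.2 (hk0 z hz)))
    have hd : DifferentiableAt ℂ (fun q => fderiv ℂ k q (Pi.single β 1)) z :=
      (differentiableOn_fderiv_apply hΩ hk _).differentiableAt (hΩ.mem_nhds hz)
    have h1 := ((hself z hz).inv hpos).mul (hasWirtingerAt_inner hd (hkd z hz))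
    have h2 : bergmanMetric Ω z α β = dz α (fun q => (((‖k q‖ ^ 2 : ℝ) : ℂ))⁻¹ *
        inner ℂ (fderiv ℂ k q (Pi.single β 1)) (k q)) z :=
      dz_congr (by filter_upwards [hΩ.mem_nhds hz] with q hq using hlog q hq β) α
    rw [h2, h1.dz α]
    field_simp
    ring

lemma hasWirtingerAt_log_normSq (hΩ : IsOpen Ω) {J : (Fin d → ℂ) → ℂ} (hJ : DifferentiableOn ℂ J Ω)
    (hJ0 : ∀ z ∈ Ω, J z ≠ 0) {z : Fin d → ℂ} (hz : z ∈ Ω) :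
    HasWirtingerAt (fun q => (Real.log (Complex.normSq (J q)) : ℂ))
      (fun i => fderiv ℂ J z (Pi.single i 1) * (J z)⁻¹)
      (fun i => conj (fderiv ℂ J z (Pi.single i 1) * (J z)⁻¹)) z := by
  have h1 := (hJ.differentiableAt (hΩ.mem_nhds hz)).hasWirtingerAt_holomorphic
  have h2 := (h1.mul h1.conj).congr (g := fun q => (Complex.normSq (J q) : ℂ))
    (Eventually.of_forall fun q => by simp only; rw [Complex.mul_conj])
  have h3 := h2.comp_ofReal (Real.hasDerivAt_log (fun h => hJ0 z hz (Complex.normSq_eq_zero.1 h)))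
  have hz0 := hJ0 z hz
  have hz1 : conj (J z) ≠ 0 := (map_ne_zero _).2 hz0
  convert h3 using 1
  · funext i
    rw [Complex.ofReal_inv, ← Complex.mul_conj]
    simp only [Pi.zero_apply, map_zero, mul_zero, zero_add]
    field_simp
  · funext i
    rw [Complex.ofReal_inv, ← Complex.mul_conj]
    simp only [Pi.zero_apply, mul_zero, add_zero, map_mul, map_inv₀]
    field_simp

/-- `log |J|²` is pluriharmonic for a nowhere vanishing holomorphic function `J`: its derivatives
`∂/∂z̄_β` are antiholomorphic. -/
lemma hasWirtingerAt_dzbar_log_normSq (hΩ : IsOpen Ω) {J : (Fin d → ℂ) → ℂ}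
    (hJ : DifferentiableOn ℂ J Ω) (hJ0 : ∀ z ∈ Ω, J z ≠ 0) {z : Fin d → ℂ} (hz : z ∈ Ω)
    (β : Fin d) :
    HasWirtingerAt (fun q => conj (fderiv ℂ J q (Pi.single β 1) * (J q)⁻¹)) 0
      (fun i => conj (fderiv ℂ (fun q => fderiv ℂ J q (Pi.single β 1) * (J q)⁻¹) z
        (Pi.single i 1))) z := by
  have h1 : DifferentiableAt ℂ (fun q => fderiv ℂ J q (Pi.single β 1) * (J q)⁻¹) z :=
    ((differentiableOn_fderiv_apply hΩ hJ _).differentiableAt (hΩ.mem_nhds hz)).mul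
      ((hJ.differentiableAt (hΩ.mem_nhds hz)).inv (hJ0 z hz))
  have h2 := h1.hasWirtingerAt_holomorphic.conj
  convert h2 using 1
  funext i
  simp

end

/-! ### The Bergman metric of a symmetric domain is Kähler–Einstein -/

section

open scoped ComplexOrder

variable {d : ℕ} {Ω : Set (Fin d → ℂ)} {s : (Fin d → ℂ) → (Fin d → ℂ)}

lemma IsHolInvolution.logKernel_eq (hΩ : IsOpen Ω) (hb : Bornology.IsBounded Ω)
    (h : IsHolInvolution Ω s) {z : Fin d → ℂ} (hz : z ∈ Ω) :
    logKernel Ω z = logKernel Ω (s z) + Real.log (Complex.normSq (jacobian s z).det) := by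
  rw [logKernel, logKernel, h.bergmanKernel_eq hΩ hz, Complex.re_mul_ofReal,
    Real.log_mul (bergmanKernel_self_re_pos hΩ hb (h.mapsTo hz)).ne'
      (fun h0 => h.det_ne_zero hΩ hz (Complex.normSq_eq_zero.1 h0))]

/-- Symmetries are isometries of the Bergman metric. -/
lemma IsHolInvolution.bergmanMetric_eq (hΩ : IsOpen Ω) (hb : Bornology.IsBounded Ω)
    (h : IsHolInvolution Ω s) {z : Fin d → ℂ} (hz : z ∈ Ω) :
    bergmanMetric Ω z
      = (jacobian s z).transpose * bergmanMetric Ω (s z) * (jacobian s z).map conj := by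
  have hJd : DifferentiableOn ℂ (fun z => (jacobian s z).det) Ω :=
    differentiableOn_det hΩ fun l k => differentiableOn_jacobian hΩ h.differentiableOn l k
  have hJ0 : ∀ z ∈ Ω, (jacobian s z).det ≠ 0 := fun z hz => h.det_ne_zero hΩ hz
  have hsd : ∀ q ∈ Ω, DifferentiableAt ℂ s q := fun q hq =>
    h.differentiableOn.differentiableAt (hΩ.mem_nhds hq)
  have hu : ∀ q ∈ Ω, DifferentiableAt ℝ (fun x => (logKernel Ω x : ℂ)) q := fun q hq =>
    ((contDiffOn_ofReal_logKernel hΩ hb 1).differentiableOn one_ne_zero).differentiableAt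
      (hΩ.mem_nhds hq)
  have hu' : ∀ m, ∀ q ∈ Ω,
      DifferentiableAt ℝ (dzbar m fun x => (logKernel Ω x : ℂ)) q := fun m q hq =>
    ((contDiffOn_dzbar hΩ (contDiffOn_ofReal_logKernel hΩ hb 2) m).differentiableOn
      one_ne_zero).differentiableAt (hΩ.mem_nhds hq)
  ext α β
  have h1 : ∀ q ∈ Ω, dzbar β (fun x => (logKernel Ω x : ℂ)) q
      = ∑ m, dzbar m (fun x => (logKernel Ω x : ℂ)) (s q) * conj (jacobian s q m β)
        + conj (fderiv ℂ (fun z => (jacobian s z).det) q (Pi.single β 1)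
          * ((jacobian s q).det)⁻¹) := by
    intro q hq
    have h2 := ((hu _ (h.mapsTo hq)).hasWirtingerAt.comp_holomorphic (hsd q hq)).add
      (hasWirtingerAt_log_normSq hΩ hJd hJ0 hq)
    have h3 := h2.congr (g := fun x => (logKernel Ω x : ℂ)) (by
      filter_upwards [hΩ.mem_nhds hq] with x hx
      rw [h.logKernel_eq hΩ hb hx]; push_cast; rfl)
    rw [h3.dzbar β]
    simp only [jacobian_apply]
  have h2 : ∀ m, HasWirtingerAt (fun q => conj (jacobian s q m β)) 0
      (fun i => conj (fderiv ℂ (fun q => jacobian s q m β) z (Pi.single i 1))) z := by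
    intro m
    have := ((differentiableOn_jacobian hΩ h.differentiableOn m β).differentiableAt
      (hΩ.mem_nhds hz)).hasWirtingerAt_holomorphic.conj
    convert this using 1
    funext i
    simp
  have h3 := (HasWirtingerAt.sum Finset.univ fun m _ =>
    ((hu' m _ (h.mapsTo hz)).hasWirtingerAt.comp_holomorphic (hsd z hz)).mul (h2 m)).add
      (hasWirtingerAt_dzbar_log_normSq hΩ hJd hJ0 hz β)
  have h4 : bergmanMetric Ω z α β = _ :=
    (dz_congr (by filter_upwards [hΩ.mem_nhds hz] with q hq using h1 q hq) α).trans (h3.dz α)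
  rw [h4]
  simp only [Pi.zero_apply, mul_zero, zero_add, add_zero, Matrix.mul_apply,
    Matrix.transpose_apply, Matrix.map_apply]
  refine Finset.sum_congr rfl fun m _ => ?_
  rw [mul_comm]
  congr 1
  refine Finset.sum_congr rfl fun l _ => ?_
  rw [jacobian_apply, mul_comm]
  rfl

lemma IsHolInvolution.det_bergmanMetric_eq (hΩ : IsOpen Ω) (hb : Bornology.IsBounded Ω)
    (h : IsHolInvolution Ω s) {z : Fin d → ℂ} (hz : z ∈ Ω) :
    (bergmanMetric Ω z).det
      = (bergmanMetric Ω (s z)).det * Complex.normSq (jacobian s z).det := by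
  have : ((jacobian s z).map conj).det = conj (jacobian s z).det :=
    ((starRingEnd ℂ).map_det (jacobian s z)).symm
  rw [h.bergmanMetric_eq hΩ hb hz, Matrix.det_mul, Matrix.det_mul, Matrix.det_transpose, this,
    ← Complex.mul_conj]
  ring

/-- On a bounded symmetric domain the volume density of the Bergman metric is a constant multiple
of the Bergman kernel. Their quotient `ψ` is invariant under the symmetry at each point `p`, whose
differential at `p` is `-1`; hence `dψ = 0`. -/
theorem IsBoundedSymmetricDomain.exists_det_bergmanMetric_eq (h : IsBoundedSymmetricDomain Ω) :
    ∃ c : ℝ, 0 < c ∧ ∀ z ∈ Ω,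
      (bergmanMetric Ω z).det = ((c * Real.exp (logKernel Ω z) : ℝ) : ℂ) := by
  have hΩ := h.isOpen
  have hb := h.isBounded
  let ψ : (Fin d → ℂ) → ℂ := fun z => (bergmanMetric Ω z).det * ((bergmanKernel Ω z z).re : ℂ)⁻¹
  have hK0 : ∀ z ∈ Ω, ((bergmanKernel Ω z z).re : ℂ) ≠ 0 := fun z hz =>
    Complex.ofReal_ne_zero.2 (bergmanKernel_self_re_pos hΩ hb hz).ne'
  have hψd : DifferentiableOn ℝ ψ Ω := by
    have h1 : ContDiffOn ℝ (1 : ℕ) (fun z => (bergmanMetric Ω z).det) Ω :=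
      contDiffOn_det fun l k => contDiffOn_bergmanMetric hΩ hb 1 l k
    have h2 : ContDiffOn ℝ (1 : ℕ) (fun z => ((bergmanKernel Ω z z).re : ℂ)) Ω :=
      Complex.ofRealCLM.contDiff.comp_contDiffOn (contDiffOn_bergmanKernel_self hΩ hb 1)
    exact (h1.differentiableOn one_ne_zero).mul ((h2.differentiableOn one_ne_zero).inv hK0)
  have hfd : ∀ p ∈ Ω, fderiv ℝ ψ p = 0 := by
    intro p hp
    obtain ⟨s, hs, hmaps, hinv, hsp, hiso⟩ := h.symmetric p hp
    have hI : IsHolInvolution Ω s := ⟨hs, hmaps, hinv⟩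
    have hψs : ∀ z ∈ Ω, ψ z = ψ (s z) := by
      intro z hz
      have hn : (Complex.normSq (jacobian s z).det : ℂ) ≠ 0 := fun h0 =>
        hI.det_ne_zero hΩ hz (Complex.normSq_eq_zero.1 (Complex.ofReal_eq_zero.1 h0))
      have hk := hK0 _ (hmaps hz)
      simp only [ψ]
      rw [hI.det_bergmanMetric_eq hΩ hb hz, hI.bergmanKernel_eq hΩ hz, Complex.re_mul_ofReal]
      push_cast
      field_simp
    have h1 : HasFDerivAt ψ (fderiv ℝ ψ p) (s p) := by
      rw [hsp]
      exact (hψd.differentiableAt (hΩ.mem_nhds hp)).hasFDerivAt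
    have h2 := h1.comp p
      ((hs.differentiableAt (hΩ.mem_nhds hp)).hasFDerivAt.restrictScalars ℝ)
    have h3 : HasFDerivAt ψ _ p := h2.congr_of_eventuallyEq
      (by filter_upwards [hΩ.mem_nhds hp] with z hz using hψs z hz)
    have h4 := (hψd.differentiableAt (hΩ.mem_nhds hp)).hasFDerivAt.unique h3
    refine ContinuousLinearMap.ext fun v => ?_
    have h5 : fderiv ℝ ψ p v = fderiv ℝ ψ p (fderiv ℂ s p v) := congrArg (fun M => M v) h4
    rw [fderiv_symmetry_eq_neg hΩ hp hs hinv hsp hiso, map_neg] at h5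
    exact self_eq_neg.1 h5
  obtain ⟨c, hc⟩ := hΩ.exists_is_const_of_fderiv_eq_zero h.isConnected.isPreconnected hψd hfd
  obtain ⟨p, hp⟩ := h.isConnected.nonempty
  have hdet : ∀ z ∈ Ω, (bergmanMetric Ω z).det = c * ((bergmanKernel Ω z z).re : ℂ) := by
    intro z hz
    rw [← hc z hz]
    simp only [ψ]
    rw [inv_mul_cancel_right₀ (hK0 z hz)]
  have hcpos : 0 < c := by
    rw [← hc p hp]
    refine mul_pos (posDef_bergmanMetric hΩ hb hp).det_pos ?_
    rw [← Complex.ofReal_inv, Complex.zero_lt_real]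
    exact inv_pos.2 (bergmanKernel_self_re_pos hΩ hb hp)
  obtain ⟨hre, him⟩ := Complex.pos_iff.1 hcpos
  refine ⟨c.re, hre, fun z hz => ?_⟩
  rw [hdet z hz, logKernel, Real.exp_log (bergmanKernel_self_re_pos hΩ hb hz), Complex.ofReal_mul]
  congr 1
  exact Complex.ext rfl him.symm

end

/-! ### Functions on `ℂᵈ⁺¹ = ℂᵈ × ℂ` -/

section Coordinates

variable {d : ℕ}

/-- The vector of `ℂᵈ⁺¹` with first `d` entries `a` and last entry `x`. -/
def snocVec (a : Fin d → ℂ) (x : ℂ) : Fin (d + 1) → ℂ := Fin.snoc (α := fun _ => ℂ) a x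

@[simp] lemma snocVec_castSucc (a : Fin d → ℂ) (x : ℂ) (j : Fin d) :
    snocVec a x j.castSucc = a j := Fin.snoc_castSucc (α := fun _ => ℂ) x a j

@[simp] lemma snocVec_last (a : Fin d → ℂ) (x : ℂ) : snocVec a x (Fin.last d) = x :=
  Fin.snoc_last (α := fun _ => ℂ) x a

@[simp] lemma init_snocVec (a : Fin d → ℂ) (x : ℂ) : Fin.init (snocVec a x) = a :=
  Fin.init_snoc (α := fun _ => ℂ) x a

/-- The projection `ℂᵈ⁺¹ → ℂᵈ` onto the first `d` coordinates. -/
noncomputable def initCLM (d : ℕ) : (Fin (d + 1) → ℂ) →L[ℝ] (Fin d → ℂ) :=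
  ContinuousLinearMap.pi fun j => ContinuousLinearMap.proj j.castSucc

variable {f : (Fin d → ℂ) → ℂ} {a b : Fin d → ℂ} {p : Fin (d + 1) → ℂ}

lemma HasWirtingerAt.comp_init (hf : HasWirtingerAt f a b (Fin.init p)) :
    HasWirtingerAt (fun q => f (Fin.init q)) (snocVec a 0) (snocVec b 0) p := by
  obtain ⟨L, hL, hv⟩ := hf
  have h1 : HasFDerivAt f L (initCLM d p) := hL
  refine ⟨_, h1.comp p (initCLM d).hasFDerivAt, fun v => ?_⟩
  rw [ContinuousLinearMap.comp_apply, hv, Fin.sum_univ_castSucc]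
  simp [initCLM]

lemma hasWirtingerAt_last :
    HasWirtingerAt (fun q : Fin (d + 1) → ℂ => q (Fin.last d)) (snocVec 0 1) 0 p := by
  refine ⟨ContinuousLinearMap.proj (Fin.last d), hasFDerivAt_apply _ _, fun v => ?_⟩
  rw [Fin.sum_univ_castSucc]
  simp

end Coordinates

/-! ### The metric of a Hartogs domain over a Kähler–Einstein base -/

section Hartogs

variable {d : ℕ}

/-- The function `E(z) - |w|²`, which is positive on the Hartogs domain `|w|² < E(z)`. -/
noncomputable def hartogsGap (E : (Fin d → ℂ) → ℝ) (q : Fin (d + 1) → ℂ) : ℝ :=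
  E (Fin.init q) - ‖q (Fin.last d)‖ ^ 2

/-- The Hartogs domain `{(z, w) | z ∈ Ω, |w|² < E(z)}`. -/
def hartogsDomain (Ω : Set (Fin d → ℂ)) (E : (Fin d → ℂ) → ℝ) : Set (Fin (d + 1) → ℂ) :=
  {p | Fin.init p ∈ Ω ∧ ‖p (Fin.last d)‖ ^ 2 < E (Fin.init p)}

/-- The metric with potential `-log (E(z) - |w|²)`. -/
noncomputable def hartogsMetric (E : (Fin d → ℂ) → ℝ) :
    (Fin (d + 1) → ℂ) → Matrix (Fin (d + 1)) (Fin (d + 1)) ℂ :=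
  metricOfPotential fun q => -Real.log (hartogsGap E q)

/-- `E = exp(-ν u + b)` for a potential `u` of a metric on `Ω` whose volume density is a constant
multiple of `exp u`, so that this metric is Kähler–Einstein with constant `-1`. -/
structure IsHartogsBase (Ω : Set (Fin d → ℂ)) (u E : (Fin d → ℂ) → ℝ) (ν b c : ℝ) : Prop where
  isOpen : IsOpen Ω
  contDiffOn : ∀ n : ℕ, ContDiffOn ℝ n u Ω
  eq_exp : ∀ z ∈ Ω, E z = Real.exp (-ν * u z + b)
  nu_pos : 0 < ν
  c_pos : 0 < c
  det_eq : ∀ z ∈ Ω, (metricOfPotential u z).det = ((c * Real.exp (u z) : ℝ) : ℂ)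

namespace IsHartogsBase

variable {Ω : Set (Fin d → ℂ)} {u E : (Fin d → ℂ) → ℝ} {ν b c : ℝ} {p : Fin (d + 1) → ℂ}

lemma E_pos (H : IsHartogsBase Ω u E ν b c) {z : Fin d → ℂ} (hz : z ∈ Ω) : 0 < E z := by
  rw [H.eq_exp z hz]
  exact Real.exp_pos _

lemma gap_pos (hp : p ∈ hartogsDomain Ω E) : 0 < hartogsGap E p := sub_pos.2 hp.2

lemma contDiffOn_E (H : IsHartogsBase Ω u E ν b c) (n : ℕ) : ContDiffOn ℝ n E Ω :=
  ((contDiffOn_const.mul (H.contDiffOn n)).add contDiffOn_const).exp.congr H.eq_exp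

lemma contDiffOn_gap (H : IsHartogsBase Ω u E ν b c) (n : ℕ) :
    ContDiffOn ℝ n (hartogsGap E) (Fin.init ⁻¹' Ω) := by
  refine ContDiffOn.sub ?_ ?_
  · exact (H.contDiffOn_E n).comp (initCLM d).contDiff.contDiffOn fun _ h => h
  · exact ((ContinuousLinearMap.proj (R := ℝ) (φ := fun _ => ℂ)
      (Fin.last d)).contDiff.norm_sq ℝ).contDiffOn

lemma isOpen_domain (H : IsHartogsBase Ω u E ν b c) : IsOpen (hartogsDomain Ω E) := by
  have h1 : IsOpen ((Fin.init : (Fin (d + 1) → ℂ) → (Fin d → ℂ)) ⁻¹' Ω) :=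
    H.isOpen.preimage (initCLM d).continuous
  have h2 := (H.contDiffOn_gap 0).continuousOn.isOpen_inter_preimage h1 (isOpen_Ioi (a := (0 : ℝ)))
  have h3 : hartogsDomain Ω E = Fin.init ⁻¹' Ω ∩ hartogsGap E ⁻¹' Set.Ioi 0 :=
    Set.ext fun _ => and_congr_right fun _ => sub_pos.symm
  rw [h3]
  exact h2

lemma contDiffOn_potential (H : IsHartogsBase Ω u E ν b c) (n : ℕ) :
    ContDiffOn ℝ n (fun q => ((-Real.log (hartogsGap E q) : ℝ) : ℂ)) (hartogsDomain Ω E) :=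
  Complex.ofRealCLM.contDiff.comp_contDiffOn
    (((H.contDiffOn_gap n).mono fun _ h => h.1).log fun _ h => (gap_pos h).ne').neg

lemma contDiffOn_base (H : IsHartogsBase Ω u E ν b c) (n : ℕ) :
    ContDiffOn ℝ n (fun q => (u (Fin.init q) : ℂ)) (hartogsDomain Ω E) :=
  Complex.ofRealCLM.contDiff.comp_contDiffOn
    ((H.contDiffOn n).comp (initCLM d).contDiff.contDiffOn fun _ h => h.1)

lemma contDiffOn_ofReal (H : IsHartogsBase Ω u E ν b c) (n : ℕ) :
    ContDiffOn ℝ n (fun z => (u z : ℂ)) Ω :=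
  Complex.ofRealCLM.contDiff.comp_contDiffOn (H.contDiffOn n)

lemma hasWirtingerAt_u (H : IsHartogsBase Ω u E ν b c) {z : Fin d → ℂ} (hz : z ∈ Ω) :
    HasWirtingerAt (fun x => (u x : ℂ)) (fun j => dz j (fun x => (u x : ℂ)) z)
      (fun j => dzbar j (fun x => (u x : ℂ)) z) z :=
  (((H.contDiffOn_ofReal 1).differentiableOn one_ne_zero).differentiableAt
    (H.isOpen.mem_nhds hz)).hasWirtingerAt

lemma hasWirtingerAt_dzbar_u (H : IsHartogsBase Ω u E ν b c) {z : Fin d → ℂ} (hz : z ∈ Ω)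
    (k : Fin d) : HasWirtingerAt (dzbar k fun x => (u x : ℂ)) (fun j => metricOfPotential u z j k)
      (fun j => dzbar j (dzbar k fun x => (u x : ℂ)) z) z :=
  (((contDiffOn_dzbar H.isOpen (H.contDiffOn_ofReal 2) k).differentiableOn
    one_ne_zero).differentiableAt (H.isOpen.mem_nhds hz)).hasWirtingerAt

lemma hasWirtingerAt_E (H : IsHartogsBase Ω u E ν b c) {z : Fin d → ℂ} (hz : z ∈ Ω) :
    HasWirtingerAt (fun x => (E x : ℂ)) (fun j => -(ν * E z * dz j (fun x => (u x : ℂ)) z))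
      (fun j => -(ν * E z * dzbar j (fun x => (u x : ℂ)) z)) z := by
  have h1 : HasDerivAt (fun t : ℝ => Real.exp (-ν * t + b))
      (Real.exp (-ν * u z + b) * (-ν)) (u z) := by
    have := (((hasDerivAt_id (u z)).const_mul (-ν)).add_const b).exp
    simpa using this
  have h2 := ((H.hasWirtingerAt_u hz).comp_ofReal h1).congr (g := fun x => (E x : ℂ)) (by
    filter_upwards [H.isOpen.mem_nhds hz] with x hx
    rw [H.eq_exp x hx])
  rw [← H.eq_exp z hz] at h2
  convert h2 using 1 <;>
  · funext j
    push_cast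
    ring

lemma hasWirtingerAt_gap (H : IsHartogsBase Ω u E ν b c) (hp : Fin.init p ∈ Ω) :
    HasWirtingerAt (fun q => (hartogsGap E q : ℂ))
      (snocVec (fun j => -(ν * E (Fin.init p) * dz j (fun x => (u x : ℂ)) (Fin.init p)))
        (-conj (p (Fin.last d))))
      (snocVec (fun j => -(ν * E (Fin.init p) * dzbar j (fun x => (u x : ℂ)) (Fin.init p)))
        (-p (Fin.last d))) p := by
  have h1 := (H.hasWirtingerAt_E hp).comp_init.sub
    (hasWirtingerAt_last.mul (hasWirtingerAt_last (d := d) (p := p)).conj)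
  have h2 := h1.congr (g := fun q => (hartogsGap E q : ℂ)) (Eventually.of_forall fun q => by
    simp only [hartogsGap]
    rw [Complex.mul_conj']
    push_cast
    rfl)
  convert h2 using 1 <;>
  · funext i
    refine Fin.lastCases ?_ (fun j => ?_) i <;> simp

lemma dzbar_potential (H : IsHartogsBase Ω u E ν b c) (hp : p ∈ hartogsDomain Ω E)
    (β : Fin (d + 1)) : dzbar β (fun q => ((-Real.log (hartogsGap E q) : ℝ) : ℂ)) p
      = snocVec (fun j => ν * (E (Fin.init p) * dzbar j (fun x => (u x : ℂ)) (Fin.init p)))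
        (p (Fin.last d)) β * (hartogsGap E p : ℂ)⁻¹ := by
  have h1 := ((H.hasWirtingerAt_gap hp.1).comp_ofReal (Real.hasDerivAt_log (gap_pos hp).ne')).neg
  have h2 := h1.congr (g := fun q => ((-Real.log (hartogsGap E q) : ℝ) : ℂ))
    (Eventually.of_forall fun q => by push_cast; rfl)
  rw [h2.dzbar β]
  refine Fin.lastCases ?_ (fun j => ?_) β <;> simp <;> ring

lemma hasWirtingerAt_gap_inv (H : IsHartogsBase Ω u E ν b c) (hp : p ∈ hartogsDomain Ω E) :
    HasWirtingerAt (fun q => (hartogsGap E q : ℂ)⁻¹)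
      (snocVec (fun j => ν * E (Fin.init p) * dz j (fun x => (u x : ℂ)) (Fin.init p)
        / hartogsGap E p ^ 2) (conj (p (Fin.last d)) / hartogsGap E p ^ 2))
      (snocVec (fun j => ν * E (Fin.init p) * dzbar j (fun x => (u x : ℂ)) (Fin.init p)
        / hartogsGap E p ^ 2) (p (Fin.last d) / hartogsGap E p ^ 2)) p := by
  convert (H.hasWirtingerAt_gap hp.1).inv (Complex.ofReal_ne_zero.2 (gap_pos hp).ne') using 1 <;>
  · funext i
    refine Fin.lastCases ?_ (fun j => ?_) i <;> simp

/-- The first `d` columns of the metric. -/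
lemma metric_castSucc (H : IsHartogsBase Ω u E ν b c) (hp : p ∈ hartogsDomain Ω E)
    (α : Fin (d + 1)) (k : Fin d) : hartogsMetric E p α k.castSucc
      = (E (Fin.init p) / hartogsGap E p ^ 2 : ℂ) * snocVec (fun j =>
          ν * hartogsGap E p * metricOfPotential u (Fin.init p) j k
            + ν ^ 2 * (p (Fin.last d) * conj (p (Fin.last d)))
              * (dz j (fun x => (u x : ℂ)) (Fin.init p)
                * dzbar k (fun x => (u x : ℂ)) (Fin.init p)))
          (ν * conj (p (Fin.last d)) * dzbar k (fun x => (u x : ℂ)) (Fin.init p)) α := by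
  have h0 : (hartogsGap E p : ℂ) ≠ 0 := Complex.ofReal_ne_zero.2 (gap_pos hp).ne'
  have h1 : hartogsMetric E p α k.castSucc = dz α (fun q => ν * ((E (Fin.init q) : ℂ)
      * dzbar k (fun x => (u x : ℂ)) (Fin.init q)) * (hartogsGap E q : ℂ)⁻¹) p :=
    dz_congr (by
      filter_upwards [H.isOpen_domain.mem_nhds hp] with q hq
      rw [H.dzbar_potential hq, snocVec_castSucc]) α
  have h2 := (((H.hasWirtingerAt_E hp.1).mul
    (H.hasWirtingerAt_dzbar_u hp.1 k)).comp_init.const_mul ν).mul (H.hasWirtingerAt_gap_inv hp)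
  have hgap : (E (Fin.init p) : ℂ)
      = hartogsGap E p + p (Fin.last d) * conj (p (Fin.last d)) := by
    rw [Complex.mul_conj', hartogsGap]; push_cast; ring
  rw [h1, h2.dz α]
  refine Fin.lastCases ?_ (fun j => ?_) α
  · simp only [snocVec_last]
    field_simp
    ring
  · simp only [snocVec_castSucc]
    rw [hgap]
    field_simp
    ring

/-- The last column of the metric. -/
lemma metric_last (H : IsHartogsBase Ω u E ν b c) (hp : p ∈ hartogsDomain Ω E)
    (α : Fin (d + 1)) : hartogsMetric E p α (Fin.last d)
      = (E (Fin.init p) / hartogsGap E p ^ 2 : ℂ) * snocVec (fun j =>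
          ν * p (Fin.last d) * dz j (fun x => (u x : ℂ)) (Fin.init p)) 1 α := by
  have h0 : (hartogsGap E p : ℂ) ≠ 0 := Complex.ofReal_ne_zero.2 (gap_pos hp).ne'
  have h1 : hartogsMetric E p α (Fin.last d)
      = dz α (fun q => q (Fin.last d) * (hartogsGap E q : ℂ)⁻¹) p :=
    dz_congr (by
      filter_upwards [H.isOpen_domain.mem_nhds hp] with q hq
      rw [H.dzbar_potential hq, snocVec_last]) α
  have h2 := (hasWirtingerAt_last (p := p)).mul (H.hasWirtingerAt_gap_inv hp)
  have hgap : (E (Fin.init p) : ℂ)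
      = hartogsGap E p + p (Fin.last d) * conj (p (Fin.last d)) := by
    rw [Complex.mul_conj', hartogsGap]; push_cast; ring
  rw [h1, h2.dz α]
  refine Fin.lastCases ?_ (fun j => ?_) α
  · simp only [snocVec_last]
    rw [hgap]
    field_simp
    ring
  · simp only [snocVec_castSucc]
    field_simp
    simp

/-- The determinant of the metric, by the Schur complement of the last diagonal entry. -/
lemma det_metric (H : IsHartogsBase Ω u E ν b c) (hp : p ∈ hartogsDomain Ω E) :
    (hartogsMetric E p).det = (((E (Fin.init p) / hartogsGap E p ^ 2) ^ (d + 1)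
      * ((ν * hartogsGap E p) ^ d * (c * Real.exp (u (Fin.init p)))) : ℝ) : ℂ) := by
  set t : ℂ := E (Fin.init p) / hartogsGap E p ^ 2 with ht
  set B := metricOfPotential u (Fin.init p) with hB
  let X : Matrix (Fin d) (Fin 1) ℂ := Matrix.of fun j _ =>
    ν * p (Fin.last d) * dz j (fun x => (u x : ℂ)) (Fin.init p)
  let Y : Matrix (Fin 1) (Fin d) ℂ := Matrix.of fun _ k =>
    ν * conj (p (Fin.last d)) * dzbar k (fun x => (u x : ℂ)) (Fin.init p)
  have h1 : (hartogsMetric E p).submatrix finSumFinEquiv finSumFinEquiv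
      = t • Matrix.fromBlocks ((ν * hartogsGap E p : ℂ) • B + X * Y) X Y 1 := by
    ext i j
    have hl : ∀ x : Fin 1, Fin.natAdd d x = Fin.last d := fun x => by
      rw [Subsingleton.elim x 0]; rfl
    rcases i with i | i <;> rcases j with j | j
    · change hartogsMetric E p i.castSucc j.castSucc = t * _
      rw [H.metric_castSucc hp, snocVec_castSucc, Matrix.fromBlocks_apply₁₁]
      simp only [Matrix.add_apply, Matrix.smul_apply, Matrix.mul_apply, X, Y, Matrix.of_apply,
        Finset.univ_unique, Finset.sum_const, Finset.card_singleton, one_smul, smul_eq_mul]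
      ring
    · change hartogsMetric E p i.castSucc (Fin.natAdd d j) = t * _
      rw [hl, H.metric_last hp, snocVec_castSucc, Matrix.fromBlocks_apply₁₂]
      rfl
    · change hartogsMetric E p (Fin.natAdd d i) j.castSucc = t * _
      rw [hl, H.metric_castSucc hp, snocVec_last, Matrix.fromBlocks_apply₂₁]
      rfl
    · change hartogsMetric E p (Fin.natAdd d i) (Fin.natAdd d j) = t * _
      rw [hl, hl, H.metric_last hp, snocVec_last, Matrix.fromBlocks_apply₂₂,
        Subsingleton.elim i j, Matrix.one_apply_eq]
  rw [← Matrix.det_submatrix_equiv_self finSumFinEquiv, h1, Matrix.det_smul,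
    Matrix.det_fromBlocks_one₂₂, add_sub_cancel_right, Matrix.det_smul, H.det_eq _ hp.1]
  simp only [Fintype.card_sum, Fintype.card_fin, ht]
  push_cast
  rfl

lemma det_metric_pos (H : IsHartogsBase Ω u E ν b c) (hp : p ∈ hartogsDomain Ω E) :
    0 < (E (Fin.init p) / hartogsGap E p ^ 2) ^ (d + 1)
      * ((ν * hartogsGap E p) ^ d * (c * Real.exp (u (Fin.init p)))) := by
  have h1 := gap_pos hp
  have h2 := H.E_pos hp.1
  have h3 := H.nu_pos
  have h4 := H.c_pos
  positivity

lemma isUnit_det (H : IsHartogsBase Ω u E ν b c) (hp : p ∈ hartogsDomain Ω E) :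
    IsUnit (hartogsMetric E p).det := by
  rw [H.det_metric hp, isUnit_iff_ne_zero, Complex.ofReal_ne_zero]
  exact (H.det_metric_pos hp).ne'

lemma log_det (H : IsHartogsBase Ω u E ν b c) (hp : p ∈ hartogsDomain Ω E) :
    Real.log (hartogsMetric E p).det.re = ((d + 1) * b + d * Real.log ν + Real.log c)
      + (1 - (d + 1) * ν) * u (Fin.init p) + (d + 2) * -Real.log (hartogsGap E p) := by
  have h1 := gap_pos hp
  have h2 := H.E_pos hp.1
  have h3 := H.nu_pos
  have h4 := H.c_pos
  rw [H.det_metric hp, Complex.ofReal_re, Real.log_mul (by positivity) (by positivity),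
    Real.log_mul (by positivity) (by positivity), Real.log_mul (by positivity) (by positivity),
    Real.log_exp, Real.log_pow, Real.log_pow, Real.log_div (by positivity) (by positivity),
    Real.log_mul (by positivity) (by positivity), Real.log_pow, H.eq_exp _ hp.1, Real.log_exp]
  push_cast
  ring

/-- The complex Hessian of `u`, pulled back to the Hartogs domain. -/
lemma metric_base (H : IsHartogsBase Ω u E ν b c) (hp : p ∈ hartogsDomain Ω E)
    (α β : Fin (d + 1)) : dz α (dzbar β fun q => (u (Fin.init q) : ℂ)) p
      = snocVec (fun k => snocVec (fun j => metricOfPotential u (Fin.init p) j k) 0 α) 0 β := by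
  have h1 : ∀ q ∈ hartogsDomain Ω E, dzbar β (fun q => (u (Fin.init q) : ℂ)) q
      = snocVec (fun k => dzbar k (fun x => (u x : ℂ)) (Fin.init q)) 0 β := fun q hq =>
    (H.hasWirtingerAt_u hq.1).comp_init.dzbar β
  rw [dz_congr (g := fun q => snocVec (fun k => dzbar k (fun x => (u x : ℂ)) (Fin.init q)) 0 β)
    (by filter_upwards [H.isOpen_domain.mem_nhds hp] with q hq using h1 q hq) α]
  refine Fin.lastCases ?_ (fun k => ?_) β
  · simp only [snocVec_last]
    exact (hasWirtingerAt_const 0).dz α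
  · simp only [snocVec_castSucc]
    exact (H.hasWirtingerAt_dzbar_u hp.1 k).comp_init.dz α

lemma ricci_metric (H : IsHartogsBase Ω u E ν b c) (hp : p ∈ hartogsDomain Ω E) :
    ricci (hartogsMetric E) p = (-(d + 2) : ℂ) • hartogsMetric E p
      + (-(1 - (d + 1) * ν) : ℂ) • Matrix.of fun α β =>
        dz α (dzbar β fun q => (u (Fin.init q) : ℂ)) p := by
  have hM := H.isOpen_domain
  set k : ℂ := (d + 1) * b + d * Real.log ν + Real.log c
  set A : ℂ := 1 - (d + 1) * ν
  have hw : ∀ {f : (Fin (d + 1) → ℂ) → ℂ}, ContDiffOn ℝ (1 : ℕ) f (hartogsDomain Ω E) →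
      ∀ q ∈ hartogsDomain Ω E, HasWirtingerAt f (fun i => dz i f q) (fun i => dzbar i f q) q :=
    fun hf q hq => ((hf.differentiableOn one_ne_zero).differentiableAt
      (hM.mem_nhds hq)).hasWirtingerAt
  ext α β
  have h1 : ∀ q ∈ hartogsDomain Ω E,
      dzbar β (fun q => (Real.log (hartogsMetric E q).det.re : ℂ)) q
        = A * dzbar β (fun q => (u (Fin.init q) : ℂ)) q
          + (d + 2) * dzbar β (fun q => ((-Real.log (hartogsGap E q) : ℝ) : ℂ)) q := by
    intro q hq
    have h2 := ((hasWirtingerAt_const k).add ((hw (H.contDiffOn_base 1) q hq).const_mul A)).add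
      ((hw (H.contDiffOn_potential 1) q hq).const_mul (d + 2))
    have h3 := h2.congr (g := fun q => (Real.log (hartogsMetric E q).det.re : ℂ)) (by
      filter_upwards [hM.mem_nhds hq] with x hx
      rw [H.log_det hx]
      push_cast
      rfl)
    rw [h3.dzbar β]
    simp
  have h2 := ((hw (contDiffOn_dzbar hM (H.contDiffOn_base 2) β) p hp).const_mul A).add
    ((hw (contDiffOn_dzbar hM (H.contDiffOn_potential 2) β) p hp).const_mul (d + 2))
  have h3 : ricci (hartogsMetric E) p α β = -_ := congrArg Neg.neg
    ((dz_congr (by filter_upwards [hM.mem_nhds hp] with q hq using h1 q hq) α).trans (h2.dz α))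
  rw [h3]
  simp only [Matrix.add_apply, Matrix.smul_apply, Matrix.of_apply, smul_eq_mul, hartogsMetric,
    metricOfPotential]
  ring

end IsHartogsBase

end Hartogs

/-! ### Scalar curvature, extremality and the Kähler–Einstein condition -/

section Hartogs

variable {d : ℕ}

lemma scalarCurvature_eq_trace {n : ℕ} (g : (Fin n → ℂ) → Matrix (Fin n) (Fin n) ℂ)
    (p : Fin n → ℂ) : scalarCurvature g p = ((g p)⁻¹ * ricci g p).trace := by
  rw [scalarCurvature, Finset.sum_comm]
  rfl

/-- A nondegenerate Kähler–Einstein metric has constant scalar curvature and so is extremal. -/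
lemma IsKahlerEinstein.isExtremal {n : ℕ} {g : (Fin n → ℂ) → Matrix (Fin n) (Fin n) ℂ}
    {U : Set (Fin n → ℂ)} (hU : IsOpen U) (hg : ∀ p ∈ U, IsUnit (g p).det)
    (h : IsKahlerEinstein g U) : IsExtremal g U := by
  obtain ⟨c, hc⟩ := h
  have hκ : ∀ p ∈ U, scalarCurvature g p = c * n := by
    intro p hp
    rw [scalarCurvature_eq_trace, hc p hp, Matrix.mul_smul, Matrix.nonsing_inv_mul _ (hg p hp),
      Matrix.trace_smul, Matrix.trace_one, Fintype.card_fin, smul_eq_mul]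
  refine (differentiableOn_const (0 : Fin n → ℂ)).congr fun p hp => ?_
  funext α
  have h1 : ∀ β, dzbar β (scalarCurvature g) p = 0 := fun β =>
    (dzbar_congr (by filter_upwards [hU.mem_nhds hp] with q hq using hκ q hq) β).trans
      ((hasWirtingerAt_const (c * n : ℂ)).dzbar β)
  simp [hamiltonianField, h1]

namespace IsHartogsBase

variable {Ω : Set (Fin d → ℂ)} {u E : (Fin d → ℂ) → ℝ} {ν b c : ℝ} {p : Fin (d + 1) → ℂ}

/-- The trace of the pulled back complex Hessian `T` of `u` with respect to the metric `g`: the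
matrix `X = g⁻¹ T` is explicit, with `h / (ν E)` in the first `d` diagonal entries and `0` in the
last one. -/
lemma trace_inv_mul_base (H : IsHartogsBase Ω u E ν b c) (hp : p ∈ hartogsDomain Ω E) :
    ((hartogsMetric E p)⁻¹ * Matrix.of fun α β =>
        dz α (dzbar β fun q => (u (Fin.init q) : ℂ)) p).trace
      = d * (hartogsGap E p / (ν * E (Fin.init p))) := by
  have h0 : (hartogsGap E p : ℂ) ≠ 0 := Complex.ofReal_ne_zero.2 (gap_pos hp).ne'
  have hE : (E (Fin.init p) : ℂ) ≠ 0 := Complex.ofReal_ne_zero.2 (H.E_pos hp.1).ne'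
  have hν : (ν : ℂ) ≠ 0 := Complex.ofReal_ne_zero.2 H.nu_pos.ne'
  set r : ℂ := hartogsGap E p / (ν * E (Fin.init p)) with hr
  let X : Matrix (Fin (d + 1)) (Fin (d + 1)) ℂ := Matrix.of fun α β =>
    snocVec (fun k => snocVec (fun j => if j = k then r else 0)
      (-(hartogsGap E p / E (Fin.init p)) * conj (p (Fin.last d))
        * dzbar k (fun x => (u x : ℂ)) (Fin.init p)) α) 0 β
  have h1 : hartogsMetric E p * X
      = Matrix.of fun α β => dz α (dzbar β fun q => (u (Fin.init q) : ℂ)) p := by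
    ext α β
    rw [Matrix.mul_apply, Fin.sum_univ_castSucc, Matrix.of_apply, H.metric_base hp]
    simp only [X, Matrix.of_apply]
    refine Fin.lastCases ?_ (fun k => ?_) β
    · simp
    · simp only [snocVec_castSucc, snocVec_last, mul_ite, mul_zero, Finset.sum_ite_eq',
        Finset.mem_univ, if_true]
      rw [H.metric_castSucc hp, H.metric_last hp, hr]
      refine Fin.lastCases ?_ (fun j => ?_) α
      · simp only [snocVec_last]
        field_simp
        ring
      · simp only [snocVec_castSucc]
        field_simp
        ring
  rw [← h1, ← Matrix.mul_assoc, Matrix.nonsing_inv_mul _ (H.isUnit_det hp), Matrix.one_mul,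
    Matrix.trace, Fin.sum_univ_castSucc]
  simp [X]

lemma scalarCurvature_metric (H : IsHartogsBase Ω u E ν b c) (hp : p ∈ hartogsDomain Ω E) :
    scalarCurvature (hartogsMetric E) p = -(d + 2) * (d + 1)
      + -((1 - (d + 1) * ν) * d / ν) * (hartogsGap E p * (E (Fin.init p) : ℂ)⁻¹) := by
  have hE : (E (Fin.init p) : ℂ) ≠ 0 := Complex.ofReal_ne_zero.2 (H.E_pos hp.1).ne'
  have hν : (ν : ℂ) ≠ 0 := Complex.ofReal_ne_zero.2 H.nu_pos.ne'
  rw [scalarCurvature_eq_trace, H.ricci_metric hp, Matrix.mul_add, Matrix.mul_smul,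
    Matrix.mul_smul, Matrix.nonsing_inv_mul _ (H.isUnit_det hp), Matrix.trace_add,
    Matrix.trace_smul, Matrix.trace_smul, H.trace_inv_mul_base hp, Matrix.trace_one,
    Fintype.card_fin]
  push_cast
  simp only [smul_eq_mul]
  field_simp

lemma hasWirtingerAt_E_inv (H : IsHartogsBase Ω u E ν b c) (hp : p ∈ hartogsDomain Ω E) :
    HasWirtingerAt (fun q => (E (Fin.init q) : ℂ)⁻¹)
      (snocVec (fun j => ν * dz j (fun x => (u x : ℂ)) (Fin.init p) / E (Fin.init p)) 0)
      (snocVec (fun j => ν * dzbar j (fun x => (u x : ℂ)) (Fin.init p) / E (Fin.init p)) 0) p := by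
  have hE : (E (Fin.init p) : ℂ) ≠ 0 := Complex.ofReal_ne_zero.2 (H.E_pos hp.1).ne'
  convert (H.hasWirtingerAt_E hp.1).comp_init.inv hE using 1 <;>
  · funext i
    refine Fin.lastCases ?_ (fun j => ?_) i
    · simp
    · simp only [snocVec_castSucc]
      field_simp

/-- The antiholomorphic differential of the scalar curvature is a multiple of the last row of the
metric, so that its gradient is vertical. -/
lemma dzbar_scalarCurvature (H : IsHartogsBase Ω u E ν b c) (hp : p ∈ hartogsDomain Ω E)
    (β : Fin (d + 1)) : dzbar β (scalarCurvature (hartogsMetric E)) p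
      = ((1 - (d + 1) * ν) * d / ν * (p (Fin.last d) * hartogsGap E p ^ 2
        * ((E (Fin.init p) : ℂ)⁻¹) ^ 2)) * hartogsMetric E p (Fin.last d) β := by
  have h0 : (hartogsGap E p : ℂ) ≠ 0 := Complex.ofReal_ne_zero.2 (gap_pos hp).ne'
  have hE : (E (Fin.init p) : ℂ) ≠ 0 := Complex.ofReal_ne_zero.2 (H.E_pos hp.1).ne'
  have hν : (ν : ℂ) ≠ 0 := Complex.ofReal_ne_zero.2 H.nu_pos.ne'
  have hgap : (E (Fin.init p) : ℂ)
      = hartogsGap E p + p (Fin.last d) * conj (p (Fin.last d)) := by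
    rw [Complex.mul_conj', hartogsGap]; push_cast; ring
  have h1 := (hasWirtingerAt_const (-(d + 2) * (d + 1) : ℂ)).add
    (((H.hasWirtingerAt_gap hp.1).mul (H.hasWirtingerAt_E_inv hp)).const_mul
      (-((1 - (d + 1) * ν) * d / ν)))
  have h2 := h1.congr (g := scalarCurvature (hartogsMetric E)) (by
    filter_upwards [H.isOpen_domain.mem_nhds hp] with q hq using H.scalarCurvature_metric hq)
  rw [h2.dzbar β]
  refine Fin.lastCases ?_ (fun k => ?_) β
  · rw [H.metric_last hp]
    simp only [snocVec_last, Pi.zero_apply]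
    field_simp
    ring
  · rw [H.metric_castSucc hp]
    simp only [snocVec_last, snocVec_castSucc, Pi.zero_apply]
    field_simp
    rw [hgap]
    ring

/-- The last component of the Hamiltonian field, up to a constant `w h² / E²`. -/
lemma hamiltonianField_last (H : IsHartogsBase Ω u E ν b c) (hp : p ∈ hartogsDomain Ω E) :
    hamiltonianField (hartogsMetric E) p (Fin.last d)
      = -2 * Complex.I * ((1 - (d + 1) * ν) * d / ν) * (p (Fin.last d) * hartogsGap E p ^ 2
        * ((E (Fin.init p) : ℂ)⁻¹) ^ 2) := by
  have h1 : ∑ β, hartogsMetric E p (Fin.last d) β * (hartogsMetric E p)⁻¹ β (Fin.last d) = 1 := by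
    rw [← Matrix.mul_apply, Matrix.mul_nonsing_inv _ (H.isUnit_det hp), Matrix.one_apply_eq]
  simp only [hamiltonianField, H.dzbar_scalarCurvature hp]
  have h2 : ∀ x : ℂ, ∑ β, (hartogsMetric E p)⁻¹ β (Fin.last d)
      * (x * hartogsMetric E p (Fin.last d) β) = x := fun x => by
    conv_rhs => rw [← mul_one x, ← h1, Finset.mul_sum]
    exact Finset.sum_congr rfl fun β _ => by ring
  rw [h2]
  ring

/-- The function `w h² / E²` is not holomorphic in `w`, since its derivative with respect to `w̄` is
`-2 w² h / E²`. -/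
theorem nu_eq_of_isExtremal (H : IsHartogsBase Ω u E ν b c) (hd : 0 < d) (hne : Ω.Nonempty)
    (h : IsExtremal (hartogsMetric E) (hartogsDomain Ω E)) : (d + 1) * ν = 1 := by
  obtain ⟨z, hz⟩ := hne
  have hEz := H.E_pos hz
  -- A point of the domain over `z` with `w ≠ 0`, where `w² h / E²` does not vanish.
  set p : Fin (d + 1) → ℂ := snocVec z (√(E z / 2) : ℝ) with hp_def
  have hp : p ∈ hartogsDomain Ω E := by
    refine ⟨by simpa [p] using hz, ?_⟩
    rw [hp_def, init_snocVec, snocVec_last, Complex.norm_real, Real.norm_eq_abs, sq_abs,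
      Real.sq_sqrt (by positivity)]
    linarith
  have hw : p (Fin.last d) ≠ 0 := by
    rw [hp_def, snocVec_last, Complex.ofReal_ne_zero]
    exact (Real.sqrt_pos.2 (by positivity)).ne'
  have h0 : (hartogsGap E p : ℂ) ≠ 0 := Complex.ofReal_ne_zero.2 (gap_pos hp).ne'
  have hE : (E (Fin.init p) : ℂ) ≠ 0 := Complex.ofReal_ne_zero.2 (H.E_pos hp.1).ne'
  have hν : (ν : ℂ) ≠ 0 := Complex.ofReal_ne_zero.2 H.nu_pos.ne'
  set A : ℂ := -2 * Complex.I * ((1 - (d + 1) * ν) * d / ν) with hA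
  have hhol : DifferentiableAt ℂ (fun q => hamiltonianField (hartogsMetric E) q (Fin.last d)) p :=
    (differentiableOn_pi.1 h (Fin.last d)).differentiableAt (H.isOpen_domain.mem_nhds hp)
  have h1 := hhol.hasWirtingerAt_holomorphic.dzbar (Fin.last d)
  have hg := H.hasWirtingerAt_gap hp.1
  have he := H.hasWirtingerAt_E_inv hp
  have h2 := (((hasWirtingerAt_last (p := p)).mul (hg.mul hg)).mul (he.mul he)).const_mul A
  have h3 := h2.congr (g := fun q => hamiltonianField (hartogsMetric E) q (Fin.last d)) (by
    filter_upwards [H.isOpen_domain.mem_nhds hp] with q hq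
    rw [H.hamiltonianField_last hq]
    ring)
  rw [h3.dzbar (Fin.last d)] at h1
  simp only [snocVec_last, Pi.zero_apply] at h1
  have h4 : A = 0 := by
    by_contra hA0
    have h5 : A * (p (Fin.last d) * p (Fin.last d) * hartogsGap E p
      * ((E (Fin.init p) : ℂ)⁻¹ * (E (Fin.init p) : ℂ)⁻¹)) ≠ 0 :=
      mul_ne_zero hA0 (mul_ne_zero (mul_ne_zero (mul_ne_zero hw hw) h0)
        (mul_ne_zero (inv_ne_zero hE) (inv_ne_zero hE)))
    apply h5
    linear_combination (-1 / 2) * h1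
  have hd0 : (d : ℂ) ≠ 0 := Nat.cast_ne_zero.2 hd.ne'
  have h5 : (1 - (d + 1) * ν : ℂ) = 0 := by
    simpa [hA, hd0, hν] using h4
  have h6 : (((1 - (d + 1) * ν : ℝ)) : ℂ) = 0 := by
    push_cast
    exact h5
  linarith [Complex.ofReal_eq_zero.1 h6]

theorem isExtremal_iff (H : IsHartogsBase Ω u E ν b c) (hd : 0 < d) (hne : Ω.Nonempty) :
    IsExtremal (hartogsMetric E) (hartogsDomain Ω E)
      ↔ IsKahlerEinstein (hartogsMetric E) (hartogsDomain Ω E) := by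
  refine ⟨fun h => ⟨-(d + 2), fun p hp => ?_⟩,
    fun h => h.isExtremal H.isOpen_domain fun p hp => H.isUnit_det hp⟩
  have hν : ((d : ℂ) + 1) * ν = 1 := by exact_mod_cast H.nu_eq_of_isExtremal hd hne h
  rw [H.ricci_metric hp, hν]
  simp

end IsHartogsBase

end Hartogs

/-- The function `N(z, z)^μ` is `exp(-ν log K(z, z) + b)` with `ν = μ / γ`. -/
lemma IsBoundedSymmetricDomain.exists_isHartogsBase {d : ℕ} {Ω : Set (Fin d → ℂ)}
    (h : IsBoundedSymmetricDomain Ω) {μ : ℝ} (hμ : 0 < μ) :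
    ∃ b c, IsHartogsBase Ω (logKernel Ω) (fun z => genericNorm Ω z ^ μ) (μ / genus Ω) b c := by
  obtain ⟨c, hc, hdet⟩ := h.exists_det_bergmanMetric_eq
  have hV : 0 < volume.real Ω := ENNReal.toReal_pos
    (h.isOpen.measure_pos volume h.isConnected.nonempty).ne' h.isBounded.measure_lt_top.ne
  have hγ : (0 : ℝ) < genus Ω := by
    rw [genus]
    positivity
  refine ⟨-(μ / genus Ω) * Real.log (volume.real Ω), c, h.isOpen,
    contDiffOn_logKernel h.isOpen h.isBounded, fun z hz => ?_, by positivity, hc, hdet⟩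
  have hK := bergmanKernel_self_re_pos h.isOpen h.isBounded hz
  rw [genericNorm, ← Real.rpow_mul (by positivity), Real.rpow_def_of_pos (by positivity),
    Real.log_mul hV.ne' hK.ne', logKernel]
  congr 1
  ring

end CartanHartogs

theorem theorem1p1 {d : ℕ} (Ω : Set (Fin d → ℂ))
    (hΩ : CartanHartogs.IsIrreducibleBoundedSymmetricDomain Ω) (μ : ℝ) (hμ : 0 < μ) :
    CartanHartogs.IsExtremal (CartanHartogs.metric Ω μ) (CartanHartogs.domain Ω μ) ↔
      CartanHartogs.IsKahlerEinstein (CartanHartogs.metric Ω μ) (CartanHartogs.domain Ω μ) := by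
  obtain ⟨b, c, H⟩ := hΩ.toIsBoundedSymmetricDomain.exists_isHartogsBase hμ
  exact H.isExtremal_iff hΩ.dim_pos hΩ.isConnected.nonempty
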